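/- For complex $a$ and $|q|<1$ put $(a;q)_\infty=\prod_{j\ge 0}(1-aq^j)$ and $(a_1,\dots,a_r;q)_\infty=(a_1;q)_\infty\cdots(a_r;q)_\infty$. Let $q,z\in\mathbb{C}$ with $0<|q|<1$, $z\neq 0$, and $zq^n\neq 1$, $z^{-1}q^n\neq 1$ for all $n\ge 1$, and let $$S_{A1}(z,q)=\sum_{n=1}^\infty \frac{q^{n}(q^{2n+1};q)_\infty}{(zq^n,z^{-1}q^n;q)_\infty},\qquad S_{A3}(z,q)=\sum_{n=1}^\infty \frac{q^{2n}(q^{2n+1};q)_\infty}{(zq^n,z^{-1}q^n;q)_\infty},$$ $$S_{C1}(z,q)=\sum_{n=1}^\infty \frac{q^{n}(q^{2n+1};q^2)_\infty(q^{n+1};q)_\infty}{(zq^n,z^{-1}q^n;q)_\infty},\qquad S_{E4}(z,q)=\sum_{n=1}^\infty \frac{q^{2n}(q^{2n+2};q^2)_\infty}{(zq^n,z^{-1}q^n;q)_\infty}.$$ Then these series, and all of the following series over $k$ (with finite inner sums over integers $n$), converge absolutely, and $$(1+z)(z,z^{-1},q;q)_\infty S_{A1}(z,q)=\sum_{k=0}^\infty\sum_{n=-\lfloor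 k/2\rfloor}^{\lfloor k/2\rfloor}(-1)^{n+k}(1-z^{k-2|n|})(1-z^{2|n|-k+1})q^{\frac{k^2-k-3n^2-n}{2}},$$ $$\begin{aligned}(1+z)(z,z^{-1},q;q)_\infty S_{A3}(z,q)&=\sum_{k=1}^\infty\sum_{n=1}^{\lfloor k/2\rfloor}(-1)^{n+k}(1-z^{k-2n+1})(1-z^{2n-k})q^{\frac{k^2-k-3n^2+n}{2}}\\&\quad-\sum_{k=1}^\infty\sum_{n=0}^{\lfloor k/2\rfloor}(-1)^{n+k}(1-z^{k-2n})(1-z^{2n-k+1})q^{\frac{k^2+k-3n^2-n}{2}},\end{aligned}$$ $$\begin{aligned}(1+z)(z,z^{-1},q;q)_\infty S_{C1}(z,q)&=\sum_{k=1}^\infty\sum_{n=0}^{\lfloor k/3\rfloor}(-1)^{n+k}(1-z^{3n-k+1})(1-z^{k-3n})q^{\frac{k^2-k}{2}-3n^2+n}\\&\quad-\sum_{k=1}^\infty\sum_{n=0}^{\lfloor k/3\rfloor}(-1)^{n+k}(1-z^{3n-k+1})(1-z^{k-3n})q^{\frac{k^2+k}{2}-3n^2-n}\\&\quad+\sum_{k=1}^\infty\sum_{n=1}^{\lfloor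 k/3\rfloor}(-1)^{n+k}(1-z^{3n-k})(1-z^{k-3n+1})q^{\frac{k^2-k}{2}-3n^2+n}\\&\quad-\sum_{k=1}^\infty\sum_{n=1}^{\lfloor k/3\rfloor}(-1)^{n+k}(1-z^{3n-k})(1-z^{k-3n+1})q^{\frac{k^2+k}{2}-3n^2-n},\end{aligned}$$ $$\begin{aligned}(1+z)(z,z^{-1},q;q)_\infty S_{E4}(z,q)&=\sum_{k=1}^\infty\sum_{n=1}^{\lfloor k/2\rfloor}(-1)^{n+k}(1-z^{2n-k})(1-z^{k-2n+1})q^{\frac{k^2-k}{2}-n^2}\\&\quad-\sum_{k=1}^\infty\sum_{n=0}^{\lfloor k/2\rfloor}(-1)^{n+k}(1-z^{2n-k+1})(1-z^{k-2n})q^{\frac{k^2+k}{2}-n^2}.\end{aligned}$$ -/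

import Mathlib

noncomputable section

/-- The infinite `q`-shifted factorial `(a; q)_∞ = ∏_{j ≥ 0} (1 - a q^j)`. -/
def qPochInf (a q : ℂ) : ℂ := ∏' j : ℕ, (1 - a * q ^ j)

/-- The `n`-th term `q^n (q^{2n+1}; q)_∞ / (z q^n, z⁻¹ q^n; q)_∞` of `S_{A1}(z, q)`. -/
def sptTermA1 (z q : ℂ) (n : ℕ) : ℂ :=
  q ^ n * qPochInf (q ^ (2 * n + 1)) q / (qPochInf (z * q ^ n) q * qPochInf (z⁻¹ * q ^ n) q)

/-- The `n`-th term `q^{2n} (q^{2n+1}; q)_∞ / (z q^n, z⁻¹ q^n; q)_∞` of `S_{A3}(z, q)`. -/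
def sptTermA3 (z q : ℂ) (n : ℕ) : ℂ :=
  q ^ (2 * n) * qPochInf (q ^ (2 * n + 1)) q /
    (qPochInf (z * q ^ n) q * qPochInf (z⁻¹ * q ^ n) q)

/-- The `n`-th term `q^n (q^{2n+1}; q²)_∞ (q^{n+1}; q)_∞ / (z q^n, z⁻¹ q^n; q)_∞` of
`S_{C1}(z, q)`. -/
def sptTermC1 (z q : ℂ) (n : ℕ) : ℂ :=
  q ^ n * (qPochInf (q ^ (2 * n + 1)) (q ^ 2) * qPochInf (q ^ (n + 1)) q) /
    (qPochInf (z * q ^ n) q * qPochInf (z⁻¹ * q ^ n) q)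

/-- The `n`-th term `q^{2n} (q^{2n+2}; q²)_∞ / (z q^n, z⁻¹ q^n; q)_∞` of `S_{E4}(z, q)`. -/
def sptTermE4 (z q : ℂ) (n : ℕ) : ℂ :=
  q ^ (2 * n) * qPochInf (q ^ (2 * n + 2)) (q ^ 2) /
    (qPochInf (z * q ^ n) q * qPochInf (z⁻¹ * q ^ n) q)

/-- The spt-crank-type function `S_{A1}(z, q)`, a sum over `n ≥ 1`. -/
def sptCrankA1 (z q : ℂ) : ℂ := ∑' n : ℕ, sptTermA1 z q (n + 1)

/-- The spt-crank-type function `S_{A3}(z, q)`, a sum over `n ≥ 1`. -/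
def sptCrankA3 (z q : ℂ) : ℂ := ∑' n : ℕ, sptTermA3 z q (n + 1)

/-- The spt-crank-type function `S_{C1}(z, q)`, a sum over `n ≥ 1`. -/
def sptCrankC1 (z q : ℂ) : ℂ := ∑' n : ℕ, sptTermC1 z q (n + 1)

/-- The spt-crank-type function `S_{E4}(z, q)`, a sum over `n ≥ 1`. -/
def sptCrankE4 (z q : ℂ) : ℂ := ∑' n : ℕ, sptTermE4 z q (n + 1)

/-- The factor `(1 + z) (z, z⁻¹, q; q)_∞`. -/
def heckePrefactor (z q : ℂ) : ℂ :=
  (1 + z) * (qPochInf z q * qPochInf z⁻¹ q * qPochInf q q)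

/-! The inner finite sums of the double series, as functions of the outer index `k`.
Integer division `k / 2`, `k / 3` is the floor; the divisions by `2` in the exponents of `q`
are exact. -/

/-- Inner sum for `A1`. -/
def heckeA1 (z q : ℂ) (k : ℤ) : ℂ :=
  ∑ n ∈ Finset.Icc (-(k / 2)) (k / 2),
    (-1) ^ (n + k) * (1 - z ^ (k - 2 * |n|)) * (1 - z ^ (2 * |n| - k + 1)) *
      q ^ ((k ^ 2 - k - 3 * n ^ 2 - n) / 2)

/-- Inner sum of the first double series for `A3`. -/
def heckeA3a (z q : ℂ) (k : ℤ) : ℂ :=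
  ∑ n ∈ Finset.Icc 1 (k / 2),
    (-1) ^ (n + k) * (1 - z ^ (k - 2 * n + 1)) * (1 - z ^ (2 * n - k)) *
      q ^ ((k ^ 2 - k - 3 * n ^ 2 + n) / 2)

/-- Inner sum of the second double series for `A3`. -/
def heckeA3b (z q : ℂ) (k : ℤ) : ℂ :=
  ∑ n ∈ Finset.Icc 0 (k / 2),
    (-1) ^ (n + k) * (1 - z ^ (k - 2 * n)) * (1 - z ^ (2 * n - k + 1)) *
      q ^ ((k ^ 2 + k - 3 * n ^ 2 - n) / 2)

/-- Inner sum of the first double series for `C1`. -/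
def heckeC1a (z q : ℂ) (k : ℤ) : ℂ :=
  ∑ n ∈ Finset.Icc 0 (k / 3),
    (-1) ^ (n + k) * (1 - z ^ (3 * n - k + 1)) * (1 - z ^ (k - 3 * n)) *
      q ^ ((k ^ 2 - k) / 2 - 3 * n ^ 2 + n)

/-- Inner sum of the second double series for `C1`. -/
def heckeC1b (z q : ℂ) (k : ℤ) : ℂ :=
  ∑ n ∈ Finset.Icc 0 (k / 3),
    (-1) ^ (n + k) * (1 - z ^ (3 * n - k + 1)) * (1 - z ^ (k - 3 * n)) *
      q ^ ((k ^ 2 + k) / 2 - 3 * n ^ 2 - n)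

/-- Inner sum of the third double series for `C1`. -/
def heckeC1c (z q : ℂ) (k : ℤ) : ℂ :=
  ∑ n ∈ Finset.Icc 1 (k / 3),
    (-1) ^ (n + k) * (1 - z ^ (3 * n - k)) * (1 - z ^ (k - 3 * n + 1)) *
      q ^ ((k ^ 2 - k) / 2 - 3 * n ^ 2 + n)

/-- Inner sum of the fourth double series for `C1`. -/
def heckeC1d (z q : ℂ) (k : ℤ) : ℂ :=
  ∑ n ∈ Finset.Icc 1 (k / 3),
    (-1) ^ (n + k) * (1 - z ^ (3 * n - k)) * (1 - z ^ (k - 3 * n + 1)) *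
      q ^ ((k ^ 2 + k) / 2 - 3 * n ^ 2 - n)

/-- Inner sum of the first double series for `E4`. -/
def heckeE4a (z q : ℂ) (k : ℤ) : ℂ :=
  ∑ n ∈ Finset.Icc 1 (k / 2),
    (-1) ^ (n + k) * (1 - z ^ (2 * n - k)) * (1 - z ^ (k - 2 * n + 1)) *
      q ^ ((k ^ 2 - k) / 2 - n ^ 2)

/-- Inner sum of the second double series for `E4`. -/
def heckeE4b (z q : ℂ) (k : ℤ) : ℂ :=
  ∑ n ∈ Finset.Icc 0 (k / 2),
    (-1) ^ (n + k) * (1 - z ^ (2 * n - k + 1)) * (1 - z ^ (k - 2 * n)) *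
      q ^ ((k ^ 2 + k) / 2 - n ^ 2)

end

/-! Let U_n be the numerator of the n-th term of one of the series. Multiplication by (z, z⁻¹; q)_∞
turns its denominator into the Laurent polynomial (z; q)_n (z⁻¹; q)_n. A finite form of the Jacobi
triple product gives the coefficients of (1 + z)(z; q)_n (z⁻¹; q)_n in closed form
(`hasSum_crankCoeff`). They are symmetric under z^{r+1} ↔ z^{-r}, and the polynomial vanishes at z =
1 when n ≥ 1, so it is a combination of the factors (1 - z^{r+1})(1 - z^{-r}) with r ≥ 0
(`hasSum_crankCoeff_mul_crankFactor`). After interchanging summations (`heckePrefactor_mul_tsum`),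
such a factor carries, up to a sign and a power of q, the weight (1 - q^{2r+1}) ∑_{n ≥ r} X_n / ((q;
q)_{n-r} (q; q)_{n+r+1}), where X_n = (q; q)_∞ (q; q)_{2n} U_n. This is a conjugate Bailey sum
relative to a = q.

For A1, A3, C1, E4 the sequence X_n is (q; q)_∞² times q^n, q^{2n}, q^n / (-q^{n+1}; q)_∞ and q^{2n}
/ (q^{2n+1}; q²)_∞ respectively. Heine's transformation, a double use of the q-binomial theorem,
makes each sum a single series. In the first two cases this is already a partial theta series; in
the other two it becomes one through identities of Rogers–Fine type (`negPochSeries_eq_tsum`,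
`pochQuotSeries_eq_tsum`), proved by iterating a functional equation under y ↦ yq.

What results is an absolutely convergent double series in r and n. Collecting it along the lines k =
j + cn, with j = r or j = r + 1 and with c = 2 (c = 3 for C1), produces the Hecke-type inner sums.
-/

open Filter Topology Finset

/-! ### Finite and infinite q-shifted factorials: limits, bounds, factorizations -/

/-- The finite `q`-shifted factorial `(a; q)_n`. -/
noncomputable def qPoch (a q : ℂ) (n : ℕ) : ℂ := ∏ j ∈ range n, (1 - a * q ^ j)

@[simp] lemma qPoch_zero (a q : ℂ) : qPoch a q 0 = 1 := by simp [qPoch]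

lemma qPoch_succ (a q : ℂ) (n : ℕ) : qPoch a q (n + 1) = qPoch a q n * (1 - a * q ^ n) := by
  simp [qPoch, prod_range_succ]

lemma qPoch_succ' (a q : ℂ) (n : ℕ) : qPoch a q (n + 1) = (1 - a) * qPoch (a * q) q n := by
  rw [qPoch, prod_range_succ', mul_comm]
  simp [qPoch, pow_succ', mul_assoc]

lemma qPoch_add (a q : ℂ) (m n : ℕ) :
    qPoch a q (m + n) = qPoch a q m * qPoch (a * q ^ m) q n := by
  simp [qPoch, prod_range_add, pow_add, mul_assoc]

lemma qPoch_zero_left (q : ℂ) (n : ℕ) : qPoch 0 q n = 1 := by simp [qPoch]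

lemma summable_norm_mul_pow {q : ℂ} (hq : ‖q‖ < 1) (a : ℂ) :
    Summable fun j : ℕ => ‖-(a * q ^ j)‖ := by
  simpa using (summable_geometric_of_lt_one (norm_nonneg q) hq).mul_left ‖a‖

lemma multipliable_one_sub_mul_pow {q : ℂ} (hq : ‖q‖ < 1) (a : ℂ) :
    Multipliable fun j : ℕ => 1 - a * q ^ j := by
  simpa [sub_eq_add_neg] using multipliable_one_add_of_summable (summable_norm_mul_pow hq a)

lemma qPochInf_eq_qPoch_mul {q : ℂ} (hq : ‖q‖ < 1) (a : ℂ) (n : ℕ) :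
    qPochInf a q = qPoch a q n * qPochInf (a * q ^ n) q := by
  have h := Multipliable.prod_mul_tprod_nat_mul' (f := fun j : ℕ => 1 - a * q ^ j) (k := n)
    (by simpa [pow_add, mul_assoc, mul_comm, mul_left_comm]
          using multipliable_one_sub_mul_pow hq (a * q ^ n))
  rw [qPochInf, ← h, qPoch, qPochInf]
  congr 2
  ext j
  ring

lemma tendsto_qPoch {q : ℂ} (hq : ‖q‖ < 1) (a : ℂ) :
    Tendsto (qPoch a q) atTop (𝓝 (qPochInf a q)) :=
  (multipliable_one_sub_mul_pow hq a).hasProd.tendsto_prod_nat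

@[simp] lemma qPochInf_zero_left (q : ℂ) : qPochInf 0 q = 1 := by simp [qPochInf]

lemma qPochInf_ne_zero {q : ℂ} (hq : ‖q‖ < 1) {a : ℂ} (h : ∀ j : ℕ, a * q ^ j ≠ 1) :
    qPochInf a q ≠ 0 := by
  have := tprod_one_add_ne_zero_of_summable (f := fun j : ℕ => -(a * q ^ j))
    (fun i => by rw [← sub_eq_add_neg]; exact sub_ne_zero.2 (h i).symm)
    (summable_norm_mul_pow hq a)
  simpa [qPochInf, sub_eq_add_neg] using this

lemma norm_mul_pow_lt_one {q : ℂ} (hq : ‖q‖ < 1) {a : ℂ} (ha : ‖a‖ < 1) (j : ℕ) :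
    ‖a * q ^ j‖ < 1 := by
  rw [norm_mul, norm_pow]
  exact (mul_le_of_le_one_right (norm_nonneg _) (pow_le_one₀ (norm_nonneg _) hq.le)).trans_lt ha

lemma ne_one_of_norm_lt_one {a : ℂ} (ha : ‖a‖ < 1) : a ≠ 1 := by
  rintro rfl; simp at ha

lemma one_sub_ne_zero_of_norm_lt_one {a : ℂ} (ha : ‖a‖ < 1) : 1 - a ≠ 0 :=
  sub_ne_zero.2 (ne_one_of_norm_lt_one ha).symm

lemma qPochInf_ne_zero_of_norm_lt_one {q : ℂ} (hq : ‖q‖ < 1) {a : ℂ} (ha : ‖a‖ < 1) :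
    qPochInf a q ≠ 0 :=
  qPochInf_ne_zero hq fun j => ne_one_of_norm_lt_one (norm_mul_pow_lt_one hq ha j)

lemma qPoch_ne_zero_of_norm_lt_one {q : ℂ} (hq : ‖q‖ < 1) {a : ℂ} (ha : ‖a‖ < 1) (n : ℕ) :
    qPoch a q n ≠ 0 :=
  left_ne_zero_of_mul (qPochInf_eq_qPoch_mul hq a n ▸ qPochInf_ne_zero_of_norm_lt_one hq ha)

lemma tendsto_mul_pow_zero {q : ℂ} (hq : ‖q‖ < 1) (a : ℂ) :
    Tendsto (fun n : ℕ => a * q ^ n) atTop (𝓝 0) := by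
  simpa using (tendsto_pow_atTop_nhds_zero_of_norm_lt_one hq).const_mul a

lemma tendsto_qPochInf_mul_pow {q : ℂ} (hq : ‖q‖ < 1) (a : ℂ) :
    Tendsto (fun n : ℕ => qPochInf (a * q ^ n) q) atTop (𝓝 1) := by
  -- Beyond this N no factor vanishes, so the tail products are the quotients of a nonzero infinite
  -- product by its partial products.
  obtain ⟨N, hN⟩ : ∃ N : ℕ, ‖a * q ^ N‖ < 1 := by
    exact ((tendsto_zero_iff_norm_tendsto_zero.1 (tendsto_mul_pow_zero hq a)).eventually
      (gt_mem_nhds one_pos)).exists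
  rw [← tendsto_add_atTop_iff_nat N]
  have h0 := qPochInf_ne_zero_of_norm_lt_one hq hN
  have h := (tendsto_const_nhds (x := qPochInf (a * q ^ N) q)).div (tendsto_qPoch hq (a * q ^ N)) h0
  rw [div_self h0] at h
  refine h.congr fun n => ?_
  rw [Pi.div_apply, div_eq_iff (qPoch_ne_zero_of_norm_lt_one hq hN n),
    qPochInf_eq_qPoch_mul hq (a * q ^ N) n]
  ring_nf

/-- Each factor is at most 1 + |q|^j in norm. Uniformity in a over the unit disc is what later
controls whole orbits a, aq, aq², …. -/
lemma exists_norm_qPoch_le {q : ℂ} (hq : ‖q‖ < 1) :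
    ∃ C : ℝ, 0 < C ∧ ∀ a : ℂ, ‖a‖ ≤ 1 → ∀ n, ‖qPoch a q n‖ ≤ C := by
  refine ⟨Real.exp (∑' j : ℕ, ‖q‖ ^ j), Real.exp_pos _, fun a ha n => ?_⟩
  have hs := summable_geometric_of_lt_one (norm_nonneg q) hq
  rw [qPoch, norm_prod]
  calc ∏ j ∈ range n, ‖1 - a * q ^ j‖ ≤ ∏ j ∈ range n, (1 + ‖q‖ ^ j) := by
        refine prod_le_prod (fun _ _ => norm_nonneg _) fun j _ => ?_
        refine (norm_sub_le _ _).trans ?_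
        rw [norm_one, norm_mul, norm_pow]
        gcongr
        exact mul_le_of_le_one_left (by positivity) ha
    _ ≤ Real.exp (∑ j ∈ range n, ‖q‖ ^ j) := Real.prod_one_add_le_exp_sum _ fun _ => by positivity
    _ ≤ _ := Real.exp_le_exp.2 (hs.sum_le_tsum _ fun _ _ => by positivity)

lemma exists_norm_le_of_tendsto {u : ℕ → ℂ} {l : ℂ} (h : Tendsto u atTop (𝓝 l)) :
    ∃ C : ℝ, 0 < C ∧ ∀ n, ‖u n‖ ≤ C := by
  obtain ⟨C, hC⟩ := (Metric.isBounded_range_of_tendsto u h).exists_norm_le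
  exact ⟨max C 1, by positivity, fun n => (hC _ ⟨n, rfl⟩).trans (le_max_left _ _)⟩

lemma exists_norm_inv_qPoch_le {q : ℂ} (hq : ‖q‖ < 1) {a : ℂ} (ha : ‖a‖ < 1) :
    ∃ C : ℝ, 0 < C ∧ ∀ n, ‖(qPoch a q n)⁻¹‖ ≤ C :=
  exists_norm_le_of_tendsto ((tendsto_qPoch hq a).inv₀ (qPochInf_ne_zero_of_norm_lt_one hq ha))

lemma norm_sq_lt_one {q : ℂ} (hq : ‖q‖ < 1) : ‖q ^ 2‖ < 1 := by
  rw [norm_pow]; exact pow_lt_one₀ (norm_nonneg _) hq two_ne_zero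

lemma qPochInf_mul_neg {q : ℂ} (hq : ‖q‖ < 1) (a : ℂ) :
    qPochInf a q * qPochInf (-a) q = qPochInf (a ^ 2) (q ^ 2) := by
  rw [qPochInf, qPochInf, ← (multipliable_one_sub_mul_pow hq a).tprod_mul
    (multipliable_one_sub_mul_pow hq (-a)), qPochInf]
  congr 1
  ext j
  ring

lemma qPochInf_even_mul_odd {q : ℂ} (hq : ‖q‖ < 1) (a : ℂ) :
    qPochInf a (q ^ 2) * qPochInf (a * q) (q ^ 2) = qPochInf a q := by
  have h2 := norm_sq_lt_one hq
  rw [qPochInf, qPochInf, qPochInf, ← tprod_even_mul_odd (f := fun j : ℕ => 1 - a * q ^ j)]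
  · congr 2
    · ext j; ring
    · ext j; ring
  · simpa [pow_mul] using multipliable_one_sub_mul_pow h2 a
  · exact (multipliable_one_sub_mul_pow h2 (a * q)).congr fun j => by ring

/-! ### The q-binomial theorem and Heine's transformation -/

/-- The coefficients `∏_{j < n} (b - a q^j) / (q; q)_n` of the homogeneous `q`-binomial series. -/
noncomputable def qBinomCoeff (q a b : ℂ) (n : ℕ) : ℂ :=
  (∏ j ∈ range n, (b - a * q ^ j)) / qPoch q q n

lemma one_sub_pow_succ_ne_zero {q : ℂ} (hq : ‖q‖ < 1) (n : ℕ) : 1 - q ^ (n + 1) ≠ 0 :=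
  one_sub_ne_zero_of_norm_lt_one (by
    rw [norm_pow]; exact pow_lt_one₀ (norm_nonneg _) hq n.succ_ne_zero)

@[simp] lemma qBinomCoeff_zero (q a b : ℂ) : qBinomCoeff q a b 0 = 1 := by simp [qBinomCoeff]

lemma qBinomCoeff_one_right (q a : ℂ) (n : ℕ) :
    qBinomCoeff q a 1 n = qPoch a q n / qPoch q q n := rfl

/-- The reason for the homogeneous form: b = 0 is allowed and yields Euler's coefficients. -/
lemma qBinomCoeff_one_zero (q : ℂ) (n : ℕ) :
    qBinomCoeff q 1 0 n = (-1) ^ n * q ^ (n.choose 2) / qPoch q q n := by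
  rw [qBinomCoeff]
  congr 1
  induction n with
  | zero => simp
  | succ n ih => rw [prod_range_succ, ih, Nat.choose_succ_succ', Nat.choose_one_right]; ring

lemma qBinomCoeff_succ {q : ℂ} (hq : ‖q‖ < 1) (a b : ℂ) (n : ℕ) :
    qBinomCoeff q a b (n + 1) * (1 - q ^ (n + 1)) = (b - a * q ^ n) * qBinomCoeff q a b n := by
  have h1 := one_sub_pow_succ_ne_zero hq n
  have h2 := qPoch_ne_zero_of_norm_lt_one hq hq n
  rw [qBinomCoeff, qBinomCoeff, qPoch_succ, prod_range_succ, ← pow_succ']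
  field_simp

lemma summable_norm_qBinomCoeff {q : ℂ} (hq : ‖q‖ < 1) (a : ℂ) {b x : ℂ} (hx : ‖b * x‖ < 1) :
    Summable fun n => ‖qBinomCoeff q a b n * x ^ n‖ := by
  obtain ⟨r, hr1, hr2⟩ := exists_between hx
  refine summable_of_ratio_norm_eventually_le hr2 ?_
  have hp := tendsto_pow_atTop_nhds_zero_of_norm_lt_one hq
  have hlim : Tendsto (fun n : ℕ => ‖(b - a * q ^ n) * x / (1 - q ^ (n + 1))‖) atTop
      (𝓝 ‖b * x‖) := by
    have h1 : Tendsto (fun n : ℕ => 1 - q ^ (n + 1)) atTop (𝓝 (1 - 0)) :=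
      tendsto_const_nhds.sub ((tendsto_add_atTop_iff_nat 1).2 hp)
    have h2 := ((tendsto_const_nhds (x := b)).sub (hp.const_mul a)).mul_const x
    simpa using (h2.div h1 (by simp)).norm
  filter_upwards [hlim.eventually (gt_mem_nhds hr1)] with n hn
  rw [norm_norm, norm_norm]
  have h1 := one_sub_pow_succ_ne_zero hq n
  have : qBinomCoeff q a b (n + 1) * x ^ (n + 1) =
      (b - a * q ^ n) * x / (1 - q ^ (n + 1)) * (qBinomCoeff q a b n * x ^ n) := by
    field_simp
    linear_combination x ^ (n + 1) * qBinomCoeff_succ hq a b n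
  rw [this, norm_mul]
  gcongr

/-- The coefficient recurrence amounts to (1 - bx) H(x) = (1 - ax) H(xq). Iterating moves the
argument to x q^k → 0, where H tends to 1. -/
lemma tsum_qBinomCoeff {q : ℂ} (hq : ‖q‖ < 1) (a : ℂ) {b x : ℂ} (hx : ‖b * x‖ < 1) :
    ∑' n, qBinomCoeff q a b n * x ^ n = qPochInf (a * x) q / qPochInf (b * x) q := by
  set H : ℂ → ℂ := fun y => ∑' n, qBinomCoeff q a b n * y ^ n with hH
  have hxk (k : ℕ) : ‖b * (x * q ^ k)‖ < 1 := by
    rw [← mul_assoc]; exact norm_mul_pow_lt_one hq hx k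
  have hsum (k : ℕ) : Summable fun n => qBinomCoeff q a b n * (x * q ^ k) ^ n :=
    (summable_norm_qBinomCoeff hq a (hxk k)).of_norm
  have hrec (k : ℕ) : (1 - b * (x * q ^ k)) * H (x * q ^ k) =
      (1 - a * (x * q ^ k)) * H (x * q ^ (k + 1)) := by
    have hs0 := hsum k
    have hs1 := hsum (k + 1)
    have e : H (x * q ^ k) - H (x * q ^ (k + 1)) =
        x * q ^ k * (b * H (x * q ^ k) - a * H (x * q ^ (k + 1))) := by
      simp only [hH]
      rw [← hs0.tsum_sub hs1, ← tsum_mul_left, ← tsum_mul_left,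
        ← (hs0.mul_left b).tsum_sub (hs1.mul_left a), ← tsum_mul_left,
        (hs0.sub hs1).tsum_eq_zero_add]
      simp only [pow_zero, sub_self, zero_add]
      refine tsum_congr fun n => ?_
      have := qBinomCoeff_succ hq a b n
      linear_combination (x * q ^ k) ^ (n + 1) * this
    linear_combination e
  have hiter (k : ℕ) : H x * qPoch (b * x) q k = qPoch (a * x) q k * H (x * q ^ k) := by
    induction k with
    | zero => simp
    | succ k ih =>
      rw [qPoch_succ, qPoch_succ]
      linear_combination (1 - b * x * q ^ k) * ih + qPoch (a * x) q k * hrec k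
  have hlim : Tendsto (fun k : ℕ => H (x * q ^ k)) atTop (𝓝 1) := by
    have h := tendsto_tsum_of_dominated_convergence (𝓕 := atTop)
      (f := fun (k : ℕ) n => qBinomCoeff q a b n * (x * q ^ k) ^ n)
      (g := fun n => qBinomCoeff q a b n * (0 : ℂ) ^ n)
      (summable_norm_qBinomCoeff hq a hx)
      (fun n => ((tendsto_mul_pow_zero hq x).pow n).const_mul _)
      (Eventually.of_forall fun k n => by
        simp only [norm_mul, norm_pow]
        gcongr
        exact mul_le_of_le_one_right (norm_nonneg _) (pow_le_one₀ (norm_nonneg _) hq.le))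
    rw [tsum_eq_single 0 (fun n hn => by simp [hn])] at h
    simpa using h
  rw [eq_div_iff (qPochInf_ne_zero_of_norm_lt_one hq hx)]
  refine tendsto_nhds_unique ((tendsto_qPoch hq (b * x)).const_mul (H x)) ?_
  simpa [hiter] using (tendsto_qPoch hq (a * x)).mul hlim

/-- A homogeneous form of Heine's transformation. -/
lemma heine_transformation {q : ℂ} (hq : ‖q‖ < 1) (a c : ℂ) {b u x : ℂ} (hx : ‖x‖ < 1)
    (hu : ‖b * u‖ < 1) :
    ∑' i : ℕ, qBinomCoeff q c 1 i * x ^ i *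
        (qPochInf (a * u * q ^ i) q / qPochInf (b * u * q ^ i) q) =
      ∑' n : ℕ, qBinomCoeff q a b n * u ^ n *
        (qPochInf (c * x * q ^ n) q / qPochInf (x * q ^ n) q) := by
  have hx' : ‖1 * x‖ < 1 := by simpa
  -- The coupling q^{in} has norm at most 1, so the product of two absolutely convergent series
  -- dominates.
  have hs : Summable (Function.uncurry fun i n : ℕ =>
      qBinomCoeff q c 1 i * x ^ i * (qBinomCoeff q a b n * u ^ n) * q ^ (i * n)) := by
    refine ((summable_norm_qBinomCoeff hq c hx').mul_of_nonneg
      (summable_norm_qBinomCoeff hq a hu) (fun _ => norm_nonneg _)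
      (fun _ => norm_nonneg _)).of_norm_bounded fun p => ?_
    simp only [Function.uncurry]
    rw [norm_mul, norm_mul, norm_pow q]
    exact mul_le_of_le_one_right (by positivity) (pow_le_one₀ (norm_nonneg _) hq.le)
  -- Expand the quotient by the q-binomial theorem at u q^i, interchange, and sum over i by the same
  -- theorem at x q^n.
  calc _ = ∑' i : ℕ, ∑' n : ℕ,
        qBinomCoeff q c 1 i * x ^ i * (qBinomCoeff q a b n * u ^ n) * q ^ (i * n) := by
        refine tsum_congr fun i => ?_
        rw [mul_assoc a, mul_assoc b, ← tsum_qBinomCoeff hq a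
          (by rw [← mul_assoc]; exact norm_mul_pow_lt_one hq hu i), ← tsum_mul_left]
        exact tsum_congr fun n => by ring
    _ = ∑' n : ℕ, ∑' i : ℕ,
        qBinomCoeff q c 1 i * x ^ i * (qBinomCoeff q a b n * u ^ n) * q ^ (i * n) :=
        hs.tsum_comm.symm
    _ = _ := by
        refine tsum_congr fun n => ?_
        have := tsum_qBinomCoeff hq c (b := 1) (x := x * q ^ n)
          (by rw [one_mul]; exact norm_mul_pow_lt_one hq hx n)
        rw [one_mul, ← mul_assoc] at this
        rw [← this, ← tsum_mul_left]
        exact tsum_congr fun i => by ring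

/-! ### Telescoping series and geometric majorants -/

lemma tsum_eq_of_telescoping {f c : ℕ → ℂ} (hf : ∀ n, f n = c n - c (n + 1)) (hs : Summable f)
    (hc : Tendsto c atTop (𝓝 0)) : ∑' n, f n = c 0 := by
  refine tendsto_nhds_unique hs.hasSum.tendsto_sum_nat ?_
  simp_rw [hf, sum_range_sub']
  simpa using hc.const_sub (c 0)

lemma summable_of_norm_le_const_mul_pow {f : ℕ → ℂ} {C r : ℝ} (hr0 : 0 ≤ r) (hr : r < 1)
    (h : ∀ n, ‖f n‖ ≤ C * r ^ n) : Summable f :=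
  ((summable_geometric_of_lt_one hr0 hr).mul_left C).of_norm_bounded h

lemma tendsto_zero_of_norm_le_const_mul_pow {f : ℕ → ℂ} {C r : ℝ} (hr0 : 0 ≤ r) (hr : r < 1)
    (h : ∀ n, ‖f n‖ ≤ C * r ^ n) : Tendsto f atTop (𝓝 0) :=
  (summable_of_norm_le_const_mul_pow hr0 hr h).tendsto_atTop_zero

lemma summable_neg_one_pow_mul_pow {q : ℂ} (hq : ‖q‖ < 1) {e : ℕ → ℕ} (he : ∀ n, n ≤ e n) :
    Summable fun n : ℕ => (-1) ^ n * q ^ e n :=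
  summable_of_norm_le_const_mul_pow (C := 1) (norm_nonneg q) hq fun n => by
    simpa using pow_le_pow_of_le_one (norm_nonneg q) hq.le (he n)

lemma norm_tsum_le_of_le_const_mul_pow {f : ℕ → ℂ} {C r : ℝ} (hr0 : 0 ≤ r) (hr : r < 1)
    (h : ∀ n, ‖f n‖ ≤ C * r ^ n) : ‖∑' n, f n‖ ≤ C * (1 - r)⁻¹ := by
  refine tsum_of_norm_bounded ?_ h
  exact (hasSum_geometric_of_lt_one hr0 hr).mul_left C

/-! ### The series `∑ (-y; q)_n (-y)^n` -/

/-- The series `∑ (-y; q)_n (-y)^n`. -/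
noncomputable def negPochSeries (q y : ℂ) : ℂ := ∑' n : ℕ, qPoch (-y) q n * (-y) ^ n

lemma exists_norm_negPochSeries_term_le {q : ℂ} (hq : ‖q‖ < 1) :
    ∃ C : ℝ, 0 < C ∧ ∀ y : ℂ, ‖y‖ < 1 → ∀ n, ‖qPoch (-y) q n * (-y) ^ n‖ ≤ C * ‖y‖ ^ n := by
  obtain ⟨C, hC, h⟩ := exists_norm_qPoch_le hq
  refine ⟨C, hC, fun y hy n => ?_⟩
  rw [norm_mul, norm_pow, norm_neg]
  gcongr
  exact h _ (by simpa using hy.le) n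

lemma summable_negPochSeries {q y : ℂ} (hq : ‖q‖ < 1) (hy : ‖y‖ < 1) :
    Summable fun n : ℕ => qPoch (-y) q n * (-y) ^ n := by
  obtain ⟨C, -, h⟩ := exists_norm_negPochSeries_term_le hq
  exact summable_of_norm_le_const_mul_pow (norm_nonneg y) hy (h y hy)

lemma norm_mul_lt_one {a b : ℂ} (ha : ‖a‖ < 1) (hb : ‖b‖ < 1) : ‖a * b‖ < 1 := by
  rw [norm_mul]; exact mul_lt_one_of_nonneg_of_lt_one_left (norm_nonneg _) ha hb.le

lemma one_add_ne_zero_of_norm_lt_one {a : ℂ} (ha : ‖a‖ < 1) : 1 + a ≠ 0 := by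
  simpa using one_sub_ne_zero_of_norm_lt_one (a := -a) (by simpa)

lemma negPochSeries_eq {q y : ℂ} (hq : ‖q‖ < 1) (hy : ‖y‖ < 1) :
    negPochSeries q y = 1 - y + y ^ 3 * q * negPochSeries q (y * q) := by
  have hyq := norm_mul_lt_one hy hq
  have h1 := one_add_ne_zero_of_norm_lt_one hy
  have hs1 := summable_negPochSeries hq hy
  have hs2 := (summable_negPochSeries hq hyq).mul_left (y ^ 3 * q)
  -- Telescoping certificate for the difference of the two series; its initial value (1 - y²)/(1 +
  -- y) is the inhomogeneous term 1 - y.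
  set c : ℕ → ℂ := fun n => qPoch (-y) q n * (-y) ^ n * (1 - y ^ 2 * q ^ n) / (1 + y) with hc
  have hlim : Tendsto c atTop (𝓝 0) := by
    have := (((tendsto_qPoch hq (-y)).mul (tendsto_pow_atTop_nhds_zero_of_norm_lt_one
      (x := -y) (by simpa))).mul ((tendsto_mul_pow_zero hq (y ^ 2)).const_sub 1)).div_const (1 + y)
    simpa using this
  have key := tsum_eq_of_telescoping (c := c) (fun n => ?_) (hs1.sub hs2) hlim
  · rw [hs1.tsum_sub hs2, tsum_mul_left] at key
    have hc0 : c 0 = 1 - y := by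
      simp only [hc, qPoch_zero, pow_zero]; field_simp; ring
    rw [hc0] at key
    rw [negPochSeries, negPochSeries]
    linear_combination key
  · have e1 : qPoch (-y) q n * (1 + y * q ^ n) = (1 + y) * qPoch (-(y * q)) q n := by
      have := qPoch_succ (-y) q n
      rw [qPoch_succ', neg_mul] at this
      linear_combination -this
    have e2 : qPoch (-(y * q)) q n = qPoch (-y) q n * (1 + y * q ^ n) / (1 + y) := by
      rw [e1]; field_simp
    simp only [hc, qPoch_succ, e2, neg_pow (y * q), mul_pow, neg_pow y, pow_succ]
    field_simp
    ring

lemma pow_mul_pow_norm_le {q y : ℂ} (hq : ‖q‖ < 1) (hy : ‖y‖ < 1) {k e f : ℕ} (he : k ≤ e) :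
    ‖y ^ e * q ^ f‖ ≤ ‖y‖ ^ k := by
  rw [norm_mul, norm_pow, norm_pow]
  exact (mul_le_of_le_one_right (by positivity) (pow_le_one₀ (norm_nonneg _) hq.le)).trans
    (pow_le_pow_of_le_one (norm_nonneg _) hy.le he)

/-- Iterate `negPochSeries_eq` along y, yq, yq², …. The factors (y q^j)³ q for j < k multiply to
y^{3k} q^{k² + k(k-1)/2}. -/
lemma negPochSeries_eq_tsum {q y : ℂ} (hq : ‖q‖ < 1) (hy : ‖y‖ < 1) :
    negPochSeries q y =
      ∑' n : ℕ, y ^ (3 * n) * q ^ (n ^ 2 + n.choose 2) * (1 - y * q ^ n) := by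
  obtain ⟨C, hC, hb⟩ := exists_norm_negPochSeries_term_le hq
  have hyk (k : ℕ) := norm_mul_pow_lt_one hq hy k
  have hylek (k : ℕ) : ‖y * q ^ k‖ ≤ ‖y‖ := by
    rw [norm_mul, norm_pow]
    exact mul_le_of_le_one_right (norm_nonneg _) (pow_le_one₀ (norm_nonneg _) hq.le)
  have hg (k : ℕ) : ‖negPochSeries q (y * q ^ k)‖ ≤ C * (1 - ‖y‖)⁻¹ :=
    norm_tsum_le_of_le_const_mul_pow (norm_nonneg y) hy fun n =>
      (hb _ (hyk k) n).trans (by gcongr; exact hylek k)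
  -- The remainder after k iterations; it tends to 0 because the series is bounded uniformly along
  -- the orbit.
  set u : ℕ → ℂ := fun k => y ^ (3 * k) * q ^ (k ^ 2 + k.choose 2) * negPochSeries q (y * q ^ k)
    with hu
  have h := tsum_eq_of_telescoping (c := u)
    (f := fun n => y ^ (3 * n) * q ^ (n ^ 2 + n.choose 2) * (1 - y * q ^ n)) (fun n => ?_) ?_ ?_
  · rw [h]; simp [hu]
  · simp only [hu]
    rw [negPochSeries_eq hq (hyk n), Nat.choose_succ_succ', Nat.choose_one_right]
    ring_nf
  · refine summable_of_norm_le_const_mul_pow (C := 2) (norm_nonneg y) hy fun n => ?_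
    rw [norm_mul, mul_comm]
    gcongr
    · refine (norm_sub_le _ _).trans ?_
      rw [norm_one]
      linarith [(hyk n).le]
    · exact pow_mul_pow_norm_le hq hy (by lia)
  · refine tendsto_zero_of_norm_le_const_mul_pow (C := C * (1 - ‖y‖)⁻¹) (norm_nonneg y) hy
      fun n => ?_
    rw [norm_mul, mul_comm]
    have := sub_pos.2 hy
    gcongr
    · exact hg n
    · exact pow_mul_pow_norm_le hq hy (by lia)

/-! ### The series `∑ (w; q)_n w^n / (-w; q)_{n+1}` -/

/-- The series `∑ (w; q)_n w^n / (-w; q)_{n+1}`. -/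
noncomputable def pochQuotSeries (q w : ℂ) : ℂ :=
  ∑' n : ℕ, qPoch w q n * w ^ n / qPoch (-w) q (n + 1)

lemma exists_norm_inv_qPoch_mul_pow_le {q a : ℂ} (hq : ‖q‖ < 1) (ha : ‖a‖ < 1) :
    ∃ C : ℝ, 0 < C ∧ ∀ k n, ‖(qPoch (a * q ^ k) q n)⁻¹‖ ≤ C := by
  obtain ⟨C, hC, h⟩ := exists_norm_inv_qPoch_le hq ha
  obtain ⟨C', hC', h'⟩ := exists_norm_qPoch_le hq
  refine ⟨C' * C, by positivity, fun k n => ?_⟩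
  have : (qPoch (a * q ^ k) q n)⁻¹ = qPoch a q k * (qPoch a q (k + n))⁻¹ := by
    rw [qPoch_add, mul_inv, ← mul_assoc, mul_inv_cancel₀ (qPoch_ne_zero_of_norm_lt_one hq ha k),
      one_mul]
  rw [this, norm_mul]
  gcongr
  exacts [h' a ha.le k, h _]

lemma exists_norm_pochQuotSeries_term_le {q w : ℂ} (hq : ‖q‖ < 1) (hw : ‖w‖ < 1) :
    ∃ C : ℝ, 0 < C ∧ ∀ k n : ℕ, ‖qPoch (w * q ^ k) q n * (w * q ^ k) ^ n /
      qPoch (-(w * q ^ k)) q (n + 1)‖ ≤ C * ‖w‖ ^ n := by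
  obtain ⟨C, hC, h⟩ := exists_norm_inv_qPoch_mul_pow_le hq (a := -w) (by simpa)
  obtain ⟨C', hC', h'⟩ := exists_norm_qPoch_le hq
  refine ⟨C' * C, by positivity, fun k n => ?_⟩
  have h1 := h k (n + 1)
  rw [neg_mul] at h1
  calc _ = ‖qPoch (w * q ^ k) q n‖ * ‖(qPoch (-(w * q ^ k)) q (n + 1))⁻¹‖ * ‖w * q ^ k‖ ^ n := by
        rw [div_eq_mul_inv, norm_mul, norm_mul, norm_pow]; ring
    _ ≤ C' * C * ‖w‖ ^ n := by
        gcongr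
        · exact h' _ (norm_mul_pow_lt_one hq hw k).le n
        · rw [norm_mul, norm_pow]
          exact mul_le_of_le_one_right (norm_nonneg _) (pow_le_one₀ (norm_nonneg _) hq.le)

lemma summable_pochQuotSeries {q w : ℂ} (hq : ‖q‖ < 1) (hw : ‖w‖ < 1) :
    Summable fun n : ℕ => qPoch w q n * w ^ n / qPoch (-w) q (n + 1) := by
  obtain ⟨C, -, h⟩ := exists_norm_pochQuotSeries_term_le hq hw
  exact summable_of_norm_le_const_mul_pow (norm_nonneg w) hw fun n => by simpa using h 0 n

lemma tendsto_qPoch_mul_pow_div {q w : ℂ} (hq : ‖q‖ < 1) (hw : ‖w‖ < 1) :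
    Tendsto (fun n : ℕ => qPoch w q n * w ^ n / qPoch (-w) q (n + 1)) atTop (𝓝 0) :=
  (summable_pochQuotSeries hq hw).tendsto_atTop_zero

lemma qPoch_mul_q {q a : ℂ} (ha : a ≠ 1) (n : ℕ) :
    qPoch (a * q) q n = qPoch a q n * (1 - a * q ^ n) / (1 - a) := by
  rw [← qPoch_succ, qPoch_succ', mul_div_cancel_left₀ _ (sub_ne_zero.2 ha.symm)]

lemma pochQuotSeries_eq {q w : ℂ} (hq : ‖q‖ < 1) (hw : ‖w‖ < 1) :
    pochQuotSeries q w = 1 - q * w ^ 2 * pochQuotSeries q (w * q) := by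
  have hwq := norm_mul_lt_one hw hq
  have hw' : ‖-w‖ < 1 := by simpa
  have hs1 := summable_pochQuotSeries hq hw
  have hs2 := (summable_pochQuotSeries hq hwq).mul_left (q * w ^ 2)
  have h1 := one_sub_ne_zero_of_norm_lt_one hw
  have h2 := one_add_ne_zero_of_norm_lt_one hw
  -- Telescoping certificate for the sum of the two series, with initial value (1 - w²)/((1 + w)(1 -
  -- w)) = 1.
  set c : ℕ → ℂ := fun n => qPoch w q n * w ^ n / qPoch (-w) q (n + 1) *
    ((1 - w ^ 2 * q ^ n) / (1 - w)) with hc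
  have hlim : Tendsto c atTop (𝓝 0) := by
    simpa using (tendsto_qPoch_mul_pow_div hq hw).mul
      (((tendsto_mul_pow_zero hq (w ^ 2)).const_sub 1).div_const (1 - w))
  have key := tsum_eq_of_telescoping (c := c) (fun n => ?_) (hs1.add hs2) hlim
  · rw [hs1.tsum_add hs2, tsum_mul_left] at key
    have hc0 : c 0 = 1 := by
      simp only [hc, qPoch_zero, pow_zero, qPoch_succ, mul_one, one_mul, sub_neg_eq_add]
      field_simp
      ring
    rw [hc0] at key
    rw [pochQuotSeries, pochQuotSeries]
    linear_combination key
  · have e1 := qPoch_mul_q (q := q) (ne_one_of_norm_lt_one hw) n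
    have e2 := qPoch_mul_q (q := q) (ne_one_of_norm_lt_one hw') (n + 1)
    have h3 := qPoch_ne_zero_of_norm_lt_one hq hw' n
    have h4 : 1 + w * q ^ n ≠ 0 := one_add_ne_zero_of_norm_lt_one (norm_mul_pow_lt_one hq hw n)
    have h5 : 1 + w * q ^ (n + 1) ≠ 0 :=
      one_add_ne_zero_of_norm_lt_one (norm_mul_pow_lt_one hq hw _)
    rw [neg_mul] at e2
    simp only [hc, e1, e2, qPoch_succ, mul_pow, neg_mul, sub_neg_eq_add, pow_succ]
    rw [pow_succ] at h5
    -- With q^n and the factorials opaque, the claim is an identity of rational functions.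
    generalize q ^ n = Q at *
    generalize qPoch (-w) q n = A at *
    have h6 : 1 + w * q * Q ≠ 0 := by rwa [mul_assoc, mul_comm q]
    rw [show w * (Q * q) = w * q * Q by ring]
    generalize hT : w * q * Q = T at *
    field_simp
    rw [← hT]
    ring

/-- Iterate `pochQuotSeries_eq`: the factors -q (w q^j)² for j < k multiply to (-1)^k w^{2k} q^{k²}.
-/
lemma pochQuotSeries_eq_tsum {q w : ℂ} (hq : ‖q‖ < 1) (hw : ‖w‖ < 1) :
    pochQuotSeries q w = ∑' n : ℕ, (-1) ^ n * (w ^ (2 * n) * q ^ n ^ 2) := by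
  obtain ⟨C, hC, hb⟩ := exists_norm_pochQuotSeries_term_le hq hw
  have hwk (k : ℕ) := norm_mul_pow_lt_one hq hw k
  have hg (k : ℕ) : ‖pochQuotSeries q (w * q ^ k)‖ ≤ C * (1 - ‖w‖)⁻¹ :=
    norm_tsum_le_of_le_const_mul_pow (norm_nonneg w) hw (hb k)
  set u : ℕ → ℂ := fun k => (-1) ^ k * (w ^ (2 * k) * q ^ k ^ 2) * pochQuotSeries q (w * q ^ k)
    with hu
  have h := tsum_eq_of_telescoping (c := u)
    (f := fun n => (-1) ^ n * (w ^ (2 * n) * q ^ n ^ 2)) (fun n => ?_) ?_ ?_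
  · rw [h]; simp [hu]
  · simp only [hu]
    rw [pochQuotSeries_eq hq (hwk n)]
    ring_nf
  · refine summable_of_norm_le_const_mul_pow (C := 1) (norm_nonneg w) hw fun n => ?_
    simpa using pow_mul_pow_norm_le hq hw (k := n) (e := 2 * n) (f := n ^ 2) (by lia)
  · refine tendsto_zero_of_norm_le_const_mul_pow (C := C * (1 - ‖w‖)⁻¹) (norm_nonneg w) hw
      fun n => ?_
    have := sub_pos.2 hw
    simp only [hu]
    rw [norm_mul, mul_comm]
    gcongr
    · exact hg n
    · simpa using pow_mul_pow_norm_le hq hw (k := n) (e := 2 * n) (f := n ^ 2) (by lia)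

/-- A contiguous relation that brings the series Heine's transformation yields for E4 back to
`pochQuotSeries`. -/
lemma one_sub_sq_mul_tsum {q w : ℂ} (hq : ‖q‖ < 1) (hw : ‖w‖ < 1) :
    (1 - w ^ 2) * ∑' n : ℕ, (1 - q ^ (n + 1)) * qPoch (w * q) q n * w ^ n /
        qPoch (-w) q (n + 2) =
      pochQuotSeries q w - q * pochQuotSeries q (w * q) := by
  have hwq := norm_mul_lt_one hw hq
  have hw' : ‖-w‖ < 1 := by simpa
  have hs1 := summable_pochQuotSeries hq hw
  have hs2 := (summable_pochQuotSeries hq hwq).mul_left q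
  have h1 := one_sub_ne_zero_of_norm_lt_one hw
  have h2 := one_add_ne_zero_of_norm_lt_one hw
  have hs3 : Summable fun n : ℕ => (1 - q ^ (n + 1)) * qPoch (w * q) q n * w ^ n /
      qPoch (-w) q (n + 2) := by
    obtain ⟨C, hC, h⟩ := exists_norm_inv_qPoch_le hq hw'
    obtain ⟨C', hC', h'⟩ := exists_norm_qPoch_le hq
    refine summable_of_norm_le_const_mul_pow (C := 2 * C' * C) (norm_nonneg w) hw fun n => ?_
    calc _ = ‖1 - q ^ (n + 1)‖ * ‖qPoch (w * q) q n‖ * ‖(qPoch (-w) q (n + 2))⁻¹‖ * ‖w‖ ^ n := by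
          rw [div_eq_mul_inv, norm_mul, norm_mul, norm_mul, norm_pow]; ring
      _ ≤ 2 * C' * C * ‖w‖ ^ n := by
          gcongr
          · refine (norm_sub_le _ _).trans ?_
            rw [norm_one, norm_pow]
            linarith [pow_le_one₀ (norm_nonneg q) hq.le (n := n + 1)]
          · exact h' _ hwq.le n
          · exact h _
  -- The factor 1 - q^n makes the initial value 0, so no inhomogeneous term appears.
  set c : ℕ → ℂ := fun n => qPoch w q n * w ^ n / qPoch (-w) q (n + 1) *
    (w * (1 - q ^ n) / (1 - w)) with hc
  have hlim : Tendsto c atTop (𝓝 0) := by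
    simpa using (tendsto_qPoch_mul_pow_div hq hw).mul
      ((((tendsto_pow_atTop_nhds_zero_of_norm_lt_one hq).const_sub 1).const_mul w).div_const
        (1 - w))
  have key := tsum_eq_of_telescoping (c := c) (fun n => ?_)
    (((hs3.mul_left (1 - w ^ 2)).sub hs1).add hs2) hlim
  · rw [((hs3.mul_left (1 - w ^ 2)).sub hs1).tsum_add hs2,
      (hs3.mul_left (1 - w ^ 2)).tsum_sub hs1, tsum_mul_left, tsum_mul_left] at key
    have hc0 : c 0 = 0 := by simp [hc]
    rw [hc0] at key
    rw [pochQuotSeries, pochQuotSeries]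
    linear_combination key
  · have e1 := qPoch_mul_q (q := q) (ne_one_of_norm_lt_one hw) n
    have e2 := qPoch_mul_q (q := q) (ne_one_of_norm_lt_one hw') (n + 1)
    have h3 := qPoch_ne_zero_of_norm_lt_one hq hw' n
    have h4 : 1 + w * q ^ n ≠ 0 := one_add_ne_zero_of_norm_lt_one (norm_mul_pow_lt_one hq hw n)
    have h5 : 1 + w * q ^ (n + 1) ≠ 0 :=
      one_add_ne_zero_of_norm_lt_one (norm_mul_pow_lt_one hq hw _)
    rw [neg_mul] at e2
    simp only [hc, e1, e2, qPoch_succ, mul_pow, neg_mul, sub_neg_eq_add, pow_succ]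
    rw [pow_succ] at h5
    generalize q ^ n = Q at *
    generalize qPoch (-w) q n = A at *
    have h6 : 1 + w * q * Q ≠ 0 := by rwa [mul_assoc, mul_comm q]
    rw [show w * (Q * q) = w * q * Q by ring]
    generalize hT : w * q * Q = T at *
    field_simp
    rw [← hT]
    ring

/-! ### Conjugate Bailey sums and their evaluation as partial theta series -/

/-- The transform `∑_{n ≥ r} X_n / ((q; q)_{n-r} (q; q)_{n+r+1})` of a sequence. -/
noncomputable def conjSum (q : ℂ) (X : ℕ → ℂ) (r : ℕ) : ℂ :=
  ∑' i : ℕ, X (r + i) / (qPoch q q i * qPoch q q (2 * r + 1 + i))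

lemma qPochInf_self_eq {q : ℂ} (hq : ‖q‖ < 1) (n : ℕ) :
    qPochInf q q = qPoch q q n * qPochInf (q * q ^ n) q :=
  qPochInf_eq_qPoch_mul hq q n

lemma norm_pow_succ_lt_one {q : ℂ} (hq : ‖q‖ < 1) (n : ℕ) : ‖q ^ (n + 1)‖ < 1 := by
  rw [pow_succ']; exact norm_mul_pow_lt_one hq hq n

/-- The signed theta-type sum `∑ (-1)^n q^{e n}`. -/
noncomputable def signedSum (q : ℂ) (e : ℕ → ℕ) : ℂ := ∑' n : ℕ, (-1) ^ n * q ^ e n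

lemma signedSum_eq_one_sub {q : ℂ} (hq : ‖q‖ < 1) {e : ℕ → ℕ} (he : ∀ n, n ≤ e n)
    (h0 : e 0 = 0) : signedSum q e = 1 - signedSum q fun n => e (n + 1) := by
  rw [signedSum, (summable_neg_one_pow_mul_pow hq he).tsum_eq_zero_add, signedSum, h0,
    sub_eq_add_neg, ← tsum_neg]
  simp [pow_succ]

lemma pow_mul_signedSum (q : ℂ) (N : ℕ) (e : ℕ → ℕ) :
    q ^ N * signedSum q e = signedSum q fun n => N + e n := by
  rw [signedSum, ← tsum_mul_left, signedSum]
  exact tsum_congr fun n => by ring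

/-- Heine's transformation with b = c = 0 and u = q^{N+1}, since (q; q)_∞ / (q; q)_{N+i} =
(q^{N+1+i}; q)_∞. -/
lemma tsum_pow_div_qPoch_mul_qPoch {q x : ℂ} (hq : ‖q‖ < 1) (hx : ‖x‖ < 1) (N : ℕ) :
    ∑' i : ℕ, qPochInf q q * x ^ i / (qPoch q q i * qPoch q q (N + i)) =
      ∑' n : ℕ, (-1) ^ n * q ^ ((n + 1).choose 2 + N * n) /
        (qPoch q q n * qPochInf (x * q ^ n) q) := by
  have h := heine_transformation hq 1 0 (b := 0) (u := q ^ (N + 1)) hx (by simp)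
  have hl : ∑' i : ℕ, qPochInf q q * x ^ i / (qPoch q q i * qPoch q q (N + i)) =
      ∑' i : ℕ, qBinomCoeff q 0 1 i * x ^ i *
        (qPochInf (1 * q ^ (N + 1) * q ^ i) q / qPochInf (0 * q ^ (N + 1) * q ^ i) q) := by
    refine tsum_congr fun i => ?_
    have h1 := qPoch_ne_zero_of_norm_lt_one hq hq (N + i)
    have h2 := qPoch_ne_zero_of_norm_lt_one hq hq i
    rw [qPochInf_self_eq hq (N + i), qBinomCoeff_one_right, qPoch_zero_left,
      show 1 * q ^ (N + 1) * q ^ i = q * q ^ (N + i) by ring]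
    simp
    field_simp
  rw [hl, h]
  refine tsum_congr fun n => ?_
  rw [qBinomCoeff_one_zero, Nat.choose_succ_succ', Nat.choose_one_right]
  simp only [zero_mul, qPochInf_zero_left]
  field_simp
  ring

lemma conjSum_pow {q : ℂ} (hq : ‖q‖ < 1) (r : ℕ) :
    conjSum q (fun n => qPochInf q q ^ 2 * q ^ n) r =
      q ^ r * signedSum q fun n => (n + 1).choose 2 + (2 * r + 1) * n := by
  have h := tsum_pow_div_qPoch_mul_qPoch hq hq (2 * r + 1)
  have e : conjSum q (fun n => qPochInf q q ^ 2 * q ^ n) r = q ^ r * (qPochInf q q *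
      ∑' i : ℕ, qPochInf q q * q ^ i / (qPoch q q i * qPoch q q (2 * r + 1 + i))) := by
    rw [conjSum, ← tsum_mul_left, ← tsum_mul_left]
    exact tsum_congr fun i => by ring
  rw [e, h, signedSum, ← tsum_mul_left (a := qPochInf q q)]
  congr 1
  refine tsum_congr fun n => ?_
  rw [← qPochInf_self_eq hq n, mul_div_cancel₀]
  exact qPochInf_ne_zero_of_norm_lt_one hq hq

/-- At x = q² the quotient (q; q)_∞ / ((q; q)_n (q^{n+2}; q)_∞) equals 1 - q^{n+1}, which splits the
series in two. -/
lemma conjSum_pow_two {q : ℂ} (hq : ‖q‖ < 1) (r : ℕ) :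
    conjSum q (fun n => qPochInf q q ^ 2 * q ^ (2 * n)) r =
      q ^ (2 * r) * (signedSum q (fun n => (n + 1).choose 2 + (2 * r + 1) * n) -
        signedSum q fun n => (n + 2).choose 2 + (2 * r + 1) * n) := by
  have h := tsum_pow_div_qPoch_mul_qPoch hq (norm_sq_lt_one hq) (2 * r + 1)
  have e : conjSum q (fun n => qPochInf q q ^ 2 * q ^ (2 * n)) r = q ^ (2 * r) * (qPochInf q q *
      ∑' i : ℕ, qPochInf q q * (q ^ 2) ^ i / (qPoch q q i * qPoch q q (2 * r + 1 + i))) := by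
    rw [conjSum, ← tsum_mul_left, ← tsum_mul_left]
    exact tsum_congr fun i => by ring
  rw [e, h, signedSum, signedSum, ← tsum_mul_left (a := qPochInf q q), ← Summable.tsum_sub]
  · congr 1
    refine tsum_congr fun n => ?_
    have h1 := qPoch_ne_zero_of_norm_lt_one hq hq n
    have h2 := qPochInf_ne_zero_of_norm_lt_one hq (norm_mul_pow_lt_one hq (norm_sq_lt_one hq) n)
    rw [qPochInf_self_eq hq (n + 1), qPoch_succ, show q * q ^ (n + 1) = q ^ 2 * q ^ n by ring,
      Nat.choose_succ_succ' (n + 1), Nat.choose_one_right]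
    field_simp
    ring
  · exact summable_neg_one_pow_mul_pow hq fun n => by nlinarith [Nat.zero_le ((n + 1).choose 2)]
  · exact summable_neg_one_pow_mul_pow hq fun n => by nlinarith [Nat.zero_le ((n + 2).choose 2)]

/-- Let S be the series on the left. Both S and ∑ (-1)^n q^{n(n-1)/2 + Nn} start with 1, and the
tail of the latter is -q^N S. -/
lemma one_sub_mul_signedSum {q : ℂ} (hq : ‖q‖ < 1) (N : ℕ) (hN : 1 ≤ N) :
    (1 - q ^ N) * signedSum q (fun n => (n + 1).choose 2 + N * n) =
      signedSum q (fun n => n.choose 2 + N * n) -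
        signedSum q fun n => (n + 2).choose 2 + N * (n + 1) := by
  have hle (n : ℕ) : n ≤ N * n := Nat.le_mul_of_pos_left n hN
  rw [sub_mul, one_mul, pow_mul_signedSum,
    signedSum_eq_one_sub hq (e := fun n => (n + 1).choose 2 + N * n)
      (fun n => (hle n).trans (Nat.le_add_left _ _)) (by simp),
    signedSum_eq_one_sub hq (e := fun n => n.choose 2 + N * n)
      (fun n => (hle n).trans (Nat.le_add_left _ _)) (by simp)]
  have : (fun n => N + ((n + 1).choose 2 + N * n)) =
      fun n => (n + 1).choose 2 + N * (n + 1) := by ext n; ring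
  rw [this]
  ring

lemma one_sub_mul_signedSum_sub {q : ℂ} (hq : ‖q‖ < 1) (N : ℕ) (hN : 1 ≤ N) :
    (1 - q ^ N) * (signedSum q (fun n => (n + 1).choose 2 + N * n) -
        signedSum q fun n => (n + 2).choose 2 + N * n) =
      signedSum q (fun n => n.choose 2 + N * n) -
        signedSum q fun n => (n + 2).choose 2 + N * n := by
  rw [mul_sub, one_sub_mul_signedSum hq N hN, sub_mul 1 _ (signedSum q _), one_mul,
    pow_mul_signedSum]
  have : (fun n => N + ((n + 2).choose 2 + N * n)) =
      fun n => (n + 2).choose 2 + N * (n + 1) := by ext n; ring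
  rw [this]
  ring

/-- With y = q^{r+1}, the sum over i = n - r has the factor (y² q^i; q)_∞ / (-y q^i; q)_∞; Heine's
transformation sends it to `negPochSeries` at y. -/
lemma conjSum_div_neg {q : ℂ} (hq : ‖q‖ < 1) (r : ℕ) :
    conjSum q (fun n => qPochInf q q ^ 2 * q ^ n / qPochInf (-q ^ (n + 1)) q) r =
      q ^ r * ∑' n : ℕ, q ^ ((r + 1) * (3 * n)) * q ^ (n ^ 2 + n.choose 2) *
        (1 - q ^ (r + 1 + n)) := by
  set y := q ^ (r + 1) with hy
  have hy1 : ‖y‖ < 1 := norm_pow_succ_lt_one hq r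
  have h := heine_transformation hq (-y) 0 (b := 1) (u := -y) hq (by simpa)
  have e : conjSum q (fun n => qPochInf q q ^ 2 * q ^ n / qPochInf (-q ^ (n + 1)) q) r =
      q ^ r * (qPochInf q q * ∑' i : ℕ, qBinomCoeff q 0 1 i * q ^ i *
        (qPochInf (-y * -y * q ^ i) q / qPochInf (1 * -y * q ^ i) q)) := by
    rw [conjSum, ← tsum_mul_left, ← tsum_mul_left]
    refine tsum_congr fun i => ?_
    have h1 := qPoch_ne_zero_of_norm_lt_one hq hq (2 * r + 1 + i)
    rw [sq, qPochInf_self_eq hq (2 * r + 1 + i), qBinomCoeff_one_right, qPoch_zero_left, hy,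
      show -q ^ (r + 1) * -q ^ (r + 1) * q ^ i = q * q ^ (2 * r + 1 + i) by ring,
      show 1 * -q ^ (r + 1) * q ^ i = -q ^ (r + i + 1) by ring]
    field_simp
    ring
  rw [e, h, ← tsum_mul_left]
  congr 1
  have e2 (n : ℕ) : qPochInf q q * (qBinomCoeff q (-y) 1 n * (-y) ^ n *
      (qPochInf (0 * q * q ^ n) q / qPochInf (q * q ^ n) q)) = qPoch (-y) q n * (-y) ^ n := by
    have h1 := qPoch_ne_zero_of_norm_lt_one hq hq n
    have h2 := qPochInf_ne_zero_of_norm_lt_one hq (norm_mul_pow_lt_one hq hq n)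
    rw [qPochInf_self_eq hq n, qBinomCoeff_one_right]
    simp only [zero_mul, qPochInf_zero_left]
    field_simp
  simp_rw [e2]
  rw [← negPochSeries, negPochSeries_eq_tsum hq hy1]
  refine tsum_congr fun n => ?_
  rw [hy, ← pow_mul, ← pow_add q (r + 1) n]

lemma one_sub_mul_conjSum_div {q : ℂ} (hq : ‖q‖ < 1) (r : ℕ) :
    (1 - q ^ (2 * r + 1)) * conjSum q
        (fun n => qPochInf q q ^ 2 * q ^ (2 * n) / qPochInf (q ^ (2 * n + 1)) (q ^ 2)) r =
      q ^ (2 * r) * (signedSum q (fun n => n ^ 2 + (2 * r + 1) * n) -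
        signedSum q fun n => (n + 1) ^ 2 + (2 * r + 1) * n) := by
  -- A square root of q^{2r+1} factors (q^{2n+1}; q²)_∞ as (w q^i; q)_∞ (-w q^i; q)_∞ for n = r + i.
  -- The final answer involves only w².
  obtain ⟨w, hw⟩ := IsAlgClosed.exists_pow_nat_eq (q ^ (2 * r + 1)) (n := 2) two_pos
  have hw1 : ‖w‖ < 1 := by
    have : ‖w‖ ^ 2 < 1 := by rw [← norm_pow, hw]; exact norm_pow_succ_lt_one hq _
    nlinarith [norm_nonneg w]
  have hwn : ‖-w‖ < 1 := by simpa
  have h := heine_transformation hq (w * q) (-w) (b := 1) (u := w) (norm_sq_lt_one hq) (by simpa)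
  have e : conjSum q
      (fun n => qPochInf q q ^ 2 * q ^ (2 * n) / qPochInf (q ^ (2 * n + 1)) (q ^ 2)) r =
      q ^ (2 * r) * (qPochInf q q / qPochInf (-w) q *
        ∑' i : ℕ, qBinomCoeff q (-w) 1 i * (q ^ 2) ^ i *
        (qPochInf (w * q * w * q ^ i) q / qPochInf (1 * w * q ^ i) q)) := by
    rw [conjSum, ← tsum_mul_left, ← tsum_mul_left]
    refine tsum_congr fun i => ?_
    have h1 := qPoch_ne_zero_of_norm_lt_one hq hq (2 * r + 1 + i)
    have h2 := qPoch_ne_zero_of_norm_lt_one hq hwn i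
    have h3 := qPochInf_ne_zero_of_norm_lt_one hq (norm_mul_pow_lt_one hq hwn i)
    have h4 := qPochInf_mul_neg hq (w * q ^ i)
    rw [show (w * q ^ i) ^ 2 = q ^ (2 * (r + i) + 1) by rw [mul_pow, hw]; ring] at h4
    rw [sq (qPochInf q q), qPochInf_self_eq hq (2 * r + 1 + i), qBinomCoeff_one_right, ← h4,
      qPochInf_eq_qPoch_mul hq (-w) i,
      show w * q * w * q ^ i = q * q ^ (2 * r + 1 + i) by
        rw [show w * q * w * q ^ i = w ^ 2 * q * q ^ i by ring, hw]; ring, one_mul,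
      ← neg_mul]
    field_simp
    ring
  have e2 (n : ℕ) : qPochInf q q / qPochInf (-w) q * (qBinomCoeff q (w * q) 1 n * w ^ n *
      (qPochInf (-w * q ^ 2 * q ^ n) q / qPochInf (q ^ 2 * q ^ n) q)) =
      (1 - q ^ (n + 1)) * qPoch (w * q) q n * w ^ n / qPoch (-w) q (n + 2) := by
    have h1 := qPoch_ne_zero_of_norm_lt_one hq hq n
    have h2 := qPochInf_ne_zero_of_norm_lt_one hq (norm_mul_pow_lt_one hq (norm_sq_lt_one hq) n)
    have h3 := qPoch_ne_zero_of_norm_lt_one hq hwn (n + 2)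
    have h4 := qPochInf_ne_zero_of_norm_lt_one hq (norm_mul_pow_lt_one hq hwn (n + 2))
    rw [qPochInf_self_eq hq (n + 1), qPoch_succ, show q * q ^ (n + 1) = q ^ 2 * q ^ n by ring,
      qPochInf_eq_qPoch_mul hq (-w) (n + 2), qBinomCoeff_one_right,
      show -w * q ^ 2 * q ^ n = -w * q ^ (n + 2) by ring]
    generalize qPochInf (-w * q ^ (n + 2)) q = B at *
    field_simp
    ring
  rw [e, h, ← tsum_mul_left]
  simp_rw [e2]
  rw [mul_left_comm, ← hw, one_sub_sq_mul_tsum hq hw1, pochQuotSeries_eq_tsum hq hw1,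
    pochQuotSeries_eq_tsum hq (norm_mul_lt_one hw1 hq), signedSum, signedSum, ← tsum_mul_left]
  congr 2
  · refine tsum_congr fun n => ?_
    rw [pow_mul w, hw]
    ring
  · refine tsum_congr fun n => ?_
    rw [mul_pow, pow_mul w, hw]
    ring

/-! ### Laurent coefficients of (1 + z)(z; q)_n (z⁻¹; q)_n -/

/-- The reciprocal of `(q; q)_k`, extended by zero to negative integers `k`. -/
noncomputable def invQPoch (q : ℂ) (k : ℤ) : ℂ := if k < 0 then 0 else (qPoch q q k.toNat)⁻¹

lemma invQPoch_natCast (q : ℂ) (k : ℕ) : invQPoch q k = (qPoch q q k)⁻¹ := by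
  simp [invQPoch]

lemma invQPoch_of_neg (q : ℂ) {k : ℤ} (hk : k < 0) : invQPoch q k = 0 := by
  simp [invQPoch, hk]

/-- At k = 0 both sides vanish, so extension by zero keeps the recurrence valid on all integers and
boundary cases disappear below. -/
lemma invQPoch_sub_one {q : ℂ} (hq : ‖q‖ < 1) (k : ℤ) :
    invQPoch q (k - 1) = (1 - q ^ k) * invQPoch q k := by
  rcases lt_trichotomy k 0 with hk | rfl | hk
  · rw [invQPoch_of_neg q hk, invQPoch_of_neg q (by lia), mul_zero]
  · rw [invQPoch_of_neg q (by lia)]; simp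
  · obtain ⟨n, rfl⟩ : ∃ n : ℕ, k = (n : ℤ) + 1 := ⟨(k - 1).toNat, by lia⟩
    rw [add_sub_cancel_right, invQPoch_natCast, ← Nat.cast_succ, invQPoch_natCast, zpow_natCast,
      Nat.succ_eq_add_one, qPoch_succ, ← pow_succ']
    have := one_sub_pow_succ_ne_zero hq n
    have := qPoch_ne_zero_of_norm_lt_one hq hq n
    field_simp

lemma exists_norm_invQPoch_le {q : ℂ} (hq : ‖q‖ < 1) :
    ∃ C : ℝ, 0 < C ∧ ∀ k, ‖invQPoch q k‖ ≤ C := by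
  obtain ⟨C, hC, h⟩ := exists_norm_inv_qPoch_le hq hq
  refine ⟨C, hC, fun k => ?_⟩
  rw [invQPoch]
  split_ifs
  · simpa using hC.le
  · exact h _

/-- The coefficient of `z ^ (r + 1)` in `(1 + z) (z; q)_n (z⁻¹; q)_n`. -/
noncomputable def crankCoeff (q : ℂ) (n : ℕ) (r : ℤ) : ℂ :=
  (-1) ^ r * q ^ (r * (r - 1) / 2) * (1 - q ^ (2 * r + 1)) * qPoch q q (2 * n) *
    (invQPoch q (n - r) * invQPoch q (n + r + 1))

lemma mul_sub_one_ediv_two_succ (r : ℤ) : (r + 1) * (r + 1 - 1) / 2 = r * (r - 1) / 2 + r := by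
  rw [show (r + 1) * (r + 1 - 1) = r * (r - 1) + r * 2 by ring, Int.add_mul_ediv_right _ _ two_ne_zero]

/-- Coefficient form of multiplication by (1 - z q^n)(1 - z⁻¹ q^n) = 1 + q^{2n} - q^n (z + z⁻¹). -/
lemma crankCoeff_succ {q : ℂ} (hq0 : q ≠ 0) (hq : ‖q‖ < 1) (n : ℕ) (r : ℤ) :
    crankCoeff q (n + 1) r = (1 + q ^ (2 * n)) * crankCoeff q n r -
      q ^ n * (crankCoeff q n (r - 1) + crankCoeff q n (r + 1)) := by
  have t1 := mul_sub_one_ediv_two_succ r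
  have t2 := mul_sub_one_ediv_two_succ (r - 1)
  rw [sub_add_cancel] at t2
  have a1 := invQPoch_sub_one hq (n - r + 1)
  have a2 := invQPoch_sub_one hq (n - r)
  have b1 := invQPoch_sub_one hq (n + r + 2)
  have b2 := invQPoch_sub_one hq (n + r + 1)
  rw [show (n : ℤ) - r + 1 - 1 = n - r by ring] at a1
  rw [show (n : ℤ) + r + 2 - 1 = n + r + 1 by ring] at b1
  rw [show (n : ℤ) + r + 1 - 1 = n + r by ring] at b2
  simp only [crankCoeff]
  rw [show ((n + 1 : ℕ) : ℤ) - r = n - r + 1 by push_cast; ring,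
    show ((n + 1 : ℕ) : ℤ) + r + 1 = n + r + 2 by push_cast; ring,
    show (n : ℤ) - (r - 1) = n - r + 1 by ring, show (n : ℤ) + (r - 1) + 1 = n + r by ring,
    show (n : ℤ) - (r + 1) = n - r - 1 by ring, show (n : ℤ) + (r + 1) + 1 = n + r + 2 by ring,
    t1, t2, a2, b2, a1, b1, show 2 * (n + 1) = 2 * n + 1 + 1 by ring, qPoch_succ, qPoch_succ]
  have hm : (-1 : ℂ) ≠ 0 := by norm_num
  generalize (r - 1) * (r - 1 - 1) / 2 = e
  generalize invQPoch q (n - r + 1) = A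
  generalize invQPoch q (n + r + 2) = B
  simp only [zpow_add₀ hq0, zpow_sub₀ hq0, zpow_add₀ hm, zpow_sub₀ hm, zpow_natCast,
    mul_add, mul_sub, two_mul, mul_one, pow_add, pow_one, zpow_ofNat]
  have hr : q ^ r ≠ 0 := zpow_ne_zero _ hq0
  generalize q ^ r = R at *
  generalize q ^ n = Q
  generalize q ^ e = E
  field_simp
  ring

/-- Reflects f(z) = z f(z⁻¹) for f(z) = (1 + z)(z; q)_n (z⁻¹; q)_n: the powers z^{r+1} and z^{-r}
have equal coefficients. -/
lemma crankCoeff_neg_sub_one {q : ℂ} (hq0 : q ≠ 0) (n : ℕ) (r : ℤ) :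
    crankCoeff q n (-(r + 1)) = crankCoeff q n r := by
  have hm : (-1 : ℂ) ≠ 0 := by norm_num
  have e : -(r + 1) * (-(r + 1) - 1) / 2 = r * (r - 1) / 2 + (2 * r + 1) := by
    rw [show -(r + 1) * (-(r + 1) - 1) = r * (r - 1) + (2 * r + 1) * 2 by ring,
      Int.add_mul_ediv_right _ _ two_ne_zero]
  have e2 : ((-1 : ℂ)) ^ (-(r + 1)) = -(-1) ^ r := by
    rw [zpow_neg, ← inv_zpow, inv_neg_one, zpow_add₀ hm]; simp
  rw [crankCoeff, crankCoeff, e, e2, zpow_add₀ hq0,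
    show 2 * -(r + 1) + 1 = -(2 * r + 1) by ring, zpow_neg,
    show (n : ℤ) - -(r + 1) = n + r + 1 by ring, show (n : ℤ) + -(r + 1) + 1 = n - r by ring]
  have : q ^ (2 * r + 1) ≠ 0 := zpow_ne_zero _ hq0
  field_simp
  ring

lemma hasSum_crankCoeff {q z : ℂ} (hq0 : q ≠ 0) (hq : ‖q‖ < 1) (hz : z ≠ 0) (n : ℕ) :
    HasSum (fun r : ℤ => crankCoeff q n r * z ^ (r + 1))
      ((1 + z) * (qPoch z q n * qPoch z⁻¹ q n)) := by
  induction n with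
  | zero =>
    have h1 : 1 - q ≠ 0 := one_sub_ne_zero_of_norm_lt_one hq
    have c1 : crankCoeff q 0 (-1) = 1 := by
      have := crankCoeff_neg_sub_one hq0 0 0
      rw [show (-1 : ℤ) = -(0 + 1) by ring, this]
      have := invQPoch_natCast q 1
      have h0 := invQPoch_natCast q 0
      simp [crankCoeff, qPoch] at this h0 ⊢
      rw [this, h0]
      field_simp
    have c0 : crankCoeff q 0 0 = 1 := by rw [← c1, ← crankCoeff_neg_sub_one hq0]; simp
    -- For n = 0 only r = -1 and r = 0 survive, giving 1 + z.
    have h := hasSum_sum_of_ne_finset_zero (L := .unconditional ℤ)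
      (f := fun r : ℤ => crankCoeff q 0 r * z ^ (r + 1))
      (s := {-1, 0}) fun r hr => by
        have : invQPoch q ((0 : ℕ) - r) * invQPoch q ((0 : ℕ) + r + 1) = 0 := by
          simp only [mem_insert, mem_singleton, not_or] at hr
          rcases lt_or_gt_of_ne hr.2 with h | h
          · rw [invQPoch_of_neg q (k := _ + r + 1) (by simp; lia), mul_zero]
          · rw [invQPoch_of_neg q (by simp; lia), zero_mul]
        simp only [crankCoeff, this]
        simp
    convert h using 1
    rw [sum_pair (by norm_num), c1, c0]
    simp
  | succ n ih =>
    have h1 := (Equiv.subRight (1 : ℤ)).hasSum_iff.2 ih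
    have h2 := (Equiv.addRight (1 : ℤ)).hasSum_iff.2 ih
    have h3 := (ih.mul_left (1 + q ^ (2 * n))).sub
      (((h1.mul_left z).add (h2.mul_left z⁻¹)).mul_left (q ^ n))
    rw [qPoch_succ, qPoch_succ]
    convert! h3.congr_fun (g := fun r : ℤ => crankCoeff q (n + 1) r * z ^ (r + 1)) fun r => ?_ using 1
    · field_simp
      ring
    · simp only [Function.comp, Equiv.subRight_apply, Equiv.coe_addRight, crankCoeff_succ hq0 hq,
        zpow_add₀ hz, zpow_sub₀ hz, zpow_one]
      field_simp

/-- The factor `(1 - z^m) (1 - z^{1-m})` with `m = r + 1`. -/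
noncomputable def crankFactor (z : ℂ) (r : ℤ) : ℂ := (1 - z ^ (r + 1)) * (1 - z ^ (-r))

/-- Pair r with -r - 1 and use z^{r+1} + z^{-r} = (1 + z) - (1 - z^{r+1})(1 - z^{-r}). The part
proportional to 1 + z drops out because (1; q)_n = 0 for n ≥ 1. -/
lemma hasSum_crankCoeff_mul_crankFactor {q z : ℂ} (hq0 : q ≠ 0) (hq : ‖q‖ < 1) (hz : z ≠ 0)
    {n : ℕ} (hn : n ≠ 0) :
    HasSum (fun r : ℕ => -crankCoeff q n r * crankFactor z r)
      ((1 + z) * (qPoch z q n * qPoch z⁻¹ q n)) := by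
  have h := (hasSum_crankCoeff hq0 hq hz n).nat_add_neg_add_one
  have h1 := (hasSum_crankCoeff hq0 hq one_ne_zero n).nat_add_neg_add_one
  have hp : qPoch 1 q n = 0 := by
    obtain ⟨m, rfl⟩ := Nat.exists_eq_succ_of_ne_zero hn
    rw [Nat.succ_eq_add_one, qPoch_succ']; simp
  rw [hp, zero_mul, mul_zero] at h1
  -- At z = 1 each pair contributes twice its coefficient, hence the division by 2.
  have h2 := h.sub (h1.mul_left ((1 + z) / 2))
  rw [mul_zero, sub_zero] at h2
  refine h2.congr_fun fun r => ?_
  simp only [crankCoeff_neg_sub_one hq0, one_zpow, crankFactor,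
    show -((r : ℤ) + 1) + 1 = -r by ring, zpow_add₀ hz, zpow_neg, zpow_one]
  have : z ^ (r : ℤ) ≠ 0 := zpow_ne_zero _ hz
  field_simp
  ring

/-! ### Absolute convergence and interchange of summation -/

lemma summable_pow_mul_pow_choose (M : ℝ) {ρ : ℝ} (h0 : 0 ≤ ρ) (h1 : ρ < 1) :
    Summable fun n : ℕ => M ^ n * ρ ^ n.choose 2 := by
  refine summable_of_ratio_norm_eventually_le (r := 1 / 2) (by norm_num) ?_
  have hlim : Tendsto (fun n : ℕ => |M| * ρ ^ n) atTop (𝓝 0) := by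
    simpa using (tendsto_pow_atTop_nhds_zero_of_lt_one h0 h1).const_mul |M|
  filter_upwards [hlim.eventually (gt_mem_nhds (show (0 : ℝ) < 1 / 2 by norm_num))] with n hn
  rw [Nat.choose_succ_succ', Nat.choose_one_right,
    show M ^ (n + 1) * ρ ^ (n + n.choose 2) = M * ρ ^ n * (M ^ n * ρ ^ n.choose 2) by ring,
    norm_mul]
  gcongr
  rw [norm_mul, Real.norm_eq_abs, norm_pow, Real.norm_of_nonneg h0]
  exact hn.le

lemma summable_norm_crankFactor {z : ℂ} {ρ : ℝ} (h0 : 0 ≤ ρ) (h1 : ρ < 1) :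
    Summable fun r : ℕ => ‖crankFactor z r‖ * ρ ^ r.choose 2 := by
  set M := max 1 (max ‖z‖ ‖z⁻¹‖)
  have hM : 1 ≤ M := le_max_left _ _
  have hb (w : ℂ) (hw : ‖w‖ ≤ M) (k : ℕ) : ‖1 - w ^ k‖ ≤ 2 * M ^ k := by
    refine (norm_sub_le _ _).trans ?_
    rw [norm_one, norm_pow, two_mul]
    gcongr
    exact one_le_pow₀ hM
  refine ((summable_pow_mul_pow_choose (M ^ 2) h0 h1).mul_left (4 * M)).of_nonneg_of_le
    (fun r => by positivity) fun r => ?_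
  rw [← mul_assoc]
  gcongr
  have e : crankFactor z r = (1 - z ^ (r + 1)) * (1 - z⁻¹ ^ r) := by
    rw [crankFactor, zpow_neg, ← inv_zpow]; norm_cast
  rw [e, norm_mul]
  calc _ ≤ 2 * M ^ (r + 1) * (2 * M ^ r) := by
        gcongr
        · exact hb _ ((le_max_left _ _).trans (le_max_right _ _)) _
        · exact hb _ ((le_max_right _ _).trans (le_max_right _ _)) _
    _ = _ := by ring

lemma zpow_mul_sub_one_ediv_two (q : ℂ) (r : ℕ) :
    q ^ ((r : ℤ) * (r - 1) / 2) = q ^ r.choose 2 := by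
  have : (r : ℤ) * (r - 1) / 2 = (r.choose 2 : ℕ) := by
    induction r with
    | zero => simp
    | succ r ih =>
      rw [Nat.cast_succ, mul_sub_one_ediv_two_succ, ih, Nat.choose_succ_succ',
        Nat.choose_one_right]
      push_cast
      ring
  rw [this, zpow_natCast]

lemma crankCoeff_natCast (q : ℂ) (n r : ℕ) :
    crankCoeff q n r = (-1) ^ r * q ^ r.choose 2 * (1 - q ^ (2 * r + 1)) * qPoch q q (2 * n) *
      (invQPoch q (n - r) * invQPoch q (n + r + 1)) := by
  rw [crankCoeff, zpow_mul_sub_one_ediv_two]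
  norm_cast

/-- The bound is uniform in n, and its quadratic exponent in r outweighs the geometric growth of the
factors in z. -/
lemma exists_norm_crankCoeff_le {q : ℂ} (hq : ‖q‖ < 1) :
    ∃ C : ℝ, 0 < C ∧ ∀ n r : ℕ, ‖crankCoeff q n r‖ ≤ C * ‖q‖ ^ r.choose 2 := by
  obtain ⟨C, hC, h⟩ := exists_norm_qPoch_le hq
  obtain ⟨C', hC', h'⟩ := exists_norm_invQPoch_le hq
  refine ⟨2 * C * (C' * C'), by positivity, fun n r => ?_⟩
  rw [crankCoeff_natCast]
  simp only [norm_mul, norm_pow, norm_neg, norm_one, one_pow, one_mul]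
  have h2 : ‖1 - q ^ (2 * r + 1)‖ ≤ 2 := by
    refine (norm_sub_le _ _).trans ?_
    rw [norm_one, norm_pow]
    linarith [pow_le_one₀ (norm_nonneg q) hq.le (n := 2 * r + 1)]
  calc _ ≤ ‖q‖ ^ r.choose 2 * 2 * C * (C' * C') := by
        gcongr
        exacts [h q hq.le _, h' _, h' _]
    _ = _ := by ring

lemma tsum_invQPoch_mul {q : ℂ} (X : ℕ → ℂ) (r : ℕ) :
    ∑' n : ℕ, invQPoch q (n - r) * invQPoch q (n + r + 1) * X n = conjSum q X r := by
  rw [conjSum, ← (add_right_injective r).tsum_eq]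
  · refine tsum_congr fun i => ?_
    rw [show ((r + i : ℕ) : ℤ) - r = (i : ℕ) by push_cast; ring,
      show ((r + i : ℕ) : ℤ) + r + 1 = (2 * r + 1 + i : ℕ) by push_cast; ring,
      invQPoch_natCast, invQPoch_natCast, div_eq_mul_inv, mul_inv]
    ring
  · intro n hn
    by_contra h
    refine hn ?_
    have : n < r := by
      by_contra h'
      exact h ⟨n - r, by simp; lia⟩
    simp only
    rw [invQPoch_of_neg q (by lia), zero_mul, zero_mul]

/-- Expansion of a series with denominators `(z q^n, z⁻¹ q^n; q)_∞` in the factors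
`(1 - z^{r+1}) (1 - z^{-r})`. -/
theorem heckePrefactor_mul_tsum {q z : ℂ} (hq0 : q ≠ 0) (hq : ‖q‖ < 1) (hz : z ≠ 0)
    (hpole : ∀ n : ℕ, 1 ≤ n → z * q ^ n ≠ 1 ∧ z⁻¹ * q ^ n ≠ 1)
    {U : ℕ → ℂ} {C : ℝ} (hU : ∀ n, ‖U n‖ ≤ C * ‖q‖ ^ n) :
    Summable (fun n : ℕ => U (n + 1) /
        (qPochInf (z * q ^ (n + 1)) q * qPochInf (z⁻¹ * q ^ (n + 1)) q)) ∧
      heckePrefactor z q * ∑' n : ℕ, U (n + 1) /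
        (qPochInf (z * q ^ (n + 1)) q * qPochInf (z⁻¹ * q ^ (n + 1)) q) =
      ∑' r : ℕ, crankFactor z r * (-1) ^ (r + 1) * q ^ r.choose 2 * ((1 - q ^ (2 * r + 1)) *
        conjSum q (fun n => qPochInf q q * (qPoch q q (2 * n) * U n)) r) := by
  constructor
  · have hlim := ((tendsto_qPochInf_mul_pow hq z).mul
      (tendsto_qPochInf_mul_pow hq z⁻¹)).inv₀ (by simp)
    obtain ⟨B, hB, h⟩ := exists_norm_le_of_tendsto hlim
    refine (summable_nat_add_iff (f := fun n : ℕ => U n /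
      (qPochInf (z * q ^ n) q * qPochInf (z⁻¹ * q ^ n) q)) 1).2
      (summable_of_norm_le_const_mul_pow (C := C * B) (norm_nonneg q) hq fun n => ?_)
    rw [div_eq_mul_inv, norm_mul]
    have h0 : 0 ≤ C * ‖q‖ ^ n := (norm_nonneg _).trans (hU n)
    calc _ ≤ C * ‖q‖ ^ n * B := by
          gcongr
          exacts [hU n, h n]
      _ = _ := by ring
  set G : ℕ → ℕ → ℂ := fun n r => -crankCoeff q n r * crankFactor z r * (qPochInf q q * U n)
    with hG
  have hsum : Summable (Function.uncurry G) := by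
    obtain ⟨B, hB, h⟩ := exists_norm_crankCoeff_le hq
    have h1 := ((summable_geometric_of_lt_one (norm_nonneg q) hq).mul_left
      (B * ‖qPochInf q q‖ * C)).mul_of_nonneg
      (summable_norm_crankFactor (z := z) (norm_nonneg q) hq)
      (fun n => by
        have : 0 ≤ C := by simpa using (norm_nonneg _).trans (hU 0)
        positivity) (fun r => by positivity)
    refine h1.of_norm_bounded fun p => ?_
    simp only [Function.uncurry, hG, norm_mul, norm_neg]
    have h0 : 0 ≤ C * ‖q‖ ^ p.1 := (norm_nonneg _).trans (hU p.1)
    calc _ ≤ B * ‖q‖ ^ p.2.choose 2 * ‖crankFactor z p.2‖ *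
          (‖qPochInf q q‖ * (C * ‖q‖ ^ p.1)) := by
          gcongr
          exacts [h _ _, hU _]
      _ = _ := by ring
  -- The infinite products in the denominator cancel against (z, z⁻¹; q)_∞, leaving the finite ones.
  have hrow (n : ℕ) : heckePrefactor z q * (U (n + 1) /
      (qPochInf (z * q ^ (n + 1)) q * qPochInf (z⁻¹ * q ^ (n + 1)) q)) = ∑' r, G (n + 1) r := by
    have hne (w : ℂ) (hw : ∀ k : ℕ, 1 ≤ k → w * q ^ k ≠ 1) :
        qPochInf (w * q ^ (n + 1)) q ≠ 0 :=
      qPochInf_ne_zero hq fun j => by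
        rw [mul_assoc, ← pow_add]; exact hw _ (by lia)
    have h1 := hne z fun k hk => (hpole k hk).1
    have h2 := hne z⁻¹ fun k hk => (hpole k hk).2
    rw [((hasSum_crankCoeff_mul_crankFactor hq0 hq hz n.succ_ne_zero).mul_right _).tsum_eq,
      heckePrefactor, qPochInf_eq_qPoch_mul hq z (n + 1), qPochInf_eq_qPoch_mul hq z⁻¹ (n + 1)]
    generalize qPochInf (z * q ^ (n + 1)) q = A at *
    generalize qPochInf (z⁻¹ * q ^ (n + 1)) q = B at *
    field_simp
  -- The row n = 0 vanishes identically, so the sum over n ≥ 1 may be taken over all n, as `conjSum`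
  -- requires at r = 0.
  have hG0 (r : ℕ) : G 0 r = 0 := by
    rcases Nat.eq_zero_or_pos r with rfl | hr
    · simp [hG, crankFactor]
    · simp only [hG, crankCoeff_natCast]
      rw [invQPoch_of_neg q (by simp; lia)]
      simp
  rw [← tsum_mul_left]
  simp_rw [hrow]
  rw [Nat.succ_injective.tsum_eq (f := fun n => ∑' r, G n r), ← hsum.tsum_comm]
  · refine tsum_congr fun r => ?_
    rw [← tsum_invQPoch_mul, ← tsum_mul_left, ← tsum_mul_left]
    refine tsum_congr fun n => ?_
    simp only [hG, crankCoeff_natCast]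
    ring
  · intro n hn
    cases n with
    | zero => simp [hG0] at hn
    | succ n => exact ⟨n, rfl⟩

/-! ### Regrouping double series along lines -/

/-- Regrouping of a double series along the lines `j + c n = k`. -/
lemma hasSum_sum_range_div {c : ℕ} (hc : 0 < c) {f : ℕ → ℕ → ℂ}
    (hf : Summable (Function.uncurry f)) :
    HasSum (fun k : ℕ => ∑ n ∈ range (k / c + 1), f (k - c * n) n) (∑' j, ∑' n, f j n) := by
  have h := hf.hasSum.tsum_fiberwise fun p => p.1 + c * p.2
  rw [show ∑' j, ∑' n, f j n = ∑' p, Function.uncurry f p from hf.tsum_prod.symm]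
  refine h.congr_fun fun k => ?_
  have hs : (fun p : ℕ × ℕ => p.1 + c * p.2) ⁻¹' {k} =
      ((range (k / c + 1)).image fun n => (k - c * n, n) : Finset (ℕ × ℕ)) := by
    ext ⟨j, n⟩
    simp only [Set.mem_preimage, Set.mem_singleton_iff, coe_image, coe_range, Set.mem_image,
      Set.mem_Iio, Prod.mk.injEq, Nat.lt_succ_iff, Nat.le_div_iff_mul_le hc]
    constructor
    · rintro rfl
      exact ⟨n, by rw [mul_comm]; lia, by lia, rfl⟩
    · rintro ⟨m, hm, h1, rfl⟩
      rw [mul_comm] at hm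
      lia
  rw [hs, Finset.tsum_subtype' _ (Function.uncurry f), sum_image]
  · rfl
  · intro a _ b _ hab
    exact (Prod.mk.inj hab).2

lemma sum_Icc_zero_natCast (K : ℕ) (g : ℤ → ℂ) :
    ∑ n ∈ Icc (0 : ℤ) K, g n = ∑ n ∈ range (K + 1), g n := by
  refine sum_nbij' Int.toNat Nat.cast ?_ ?_ ?_ ?_ ?_ <;> intro a ha <;>
    simp only [mem_Icc, mem_range] at ha ⊢
  · lia
  · lia
  · lia
  · simp
  · rw [Int.toNat_of_nonneg ha.1]

/-- A sequence with its zeroth term replaced by zero. -/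
def dropZero (u : ℕ → ℂ) (n : ℕ) : ℂ := if n = 0 then 0 else u n

@[simp] lemma dropZero_zero (u : ℕ → ℂ) : dropZero u 0 = 0 := if_pos rfl

@[simp] lemma dropZero_succ (u : ℕ → ℂ) (n : ℕ) : dropZero u (n + 1) = u (n + 1) :=
  if_neg n.succ_ne_zero

/-- A start at n = 1 is encoded as a zero weight at n = 0, so that all inner sums share one index
range. -/
lemma sum_Icc_one_natCast (K : ℕ) (g : ℤ → ℂ) :
    ∑ n ∈ Icc (1 : ℤ) K, g n = ∑ n ∈ range (K + 1), dropZero (fun n => g n) n := by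
  rw [sum_range_succ']
  simp only [dropZero_succ, dropZero_zero, add_zero]
  refine sum_nbij' (fun n => (n - 1).toNat) (fun n => (n : ℤ) + 1) ?_ ?_ ?_ ?_ ?_ <;>
    intro a ha <;> simp only [mem_Icc, mem_range] at ha ⊢
  · lia
  · lia
  · lia
  · simp
  · congr 1; lia

lemma sum_Icc_neg_natCast (K : ℕ) (g : ℤ → ℂ) :
    ∑ n ∈ Icc (-(K : ℤ)) K, g n =
      ∑ n ∈ range (K + 1), g n + ∑ n ∈ range (K + 1), dropZero (fun n => g (-n)) n := by
  rw [← sum_Icc_zero_natCast, ← sum_Icc_one_natCast K fun n => g (-n)]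
  have hd : Disjoint (Icc (0 : ℤ) K) (Icc (-(K : ℤ)) (-1)) := by
    rw [disjoint_left]; intro a; simp only [mem_Icc]; lia
  have hu : Icc (-(K : ℤ)) K = Icc (0 : ℤ) K ∪ Icc (-(K : ℤ)) (-1) := by
    ext a; simp only [mem_Icc, mem_union]; lia
  rw [hu, sum_union hd]
  congr 1
  refine sum_nbij' (fun n => -n) (fun n => -n) ?_ ?_ ?_ ?_ ?_ <;>
    intro a ha <;> simp only [mem_Icc, neg_neg] at ha ⊢ <;> lia

/-! ### Weighted theta series and grids of terms -/

/-- The series `∑ ε_n q^{e n}`. -/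
noncomputable def weightedSum (q : ℂ) (ε : ℕ → ℂ) (e : ℕ → ℕ) : ℂ := ∑' n : ℕ, ε n * q ^ e n

lemma weightedSum_neg_one_pow (q : ℂ) (e : ℕ → ℕ) :
    weightedSum q (fun n => (-1) ^ n) e = signedSum q e := rfl

lemma weightedSum_add (q : ℂ) (ε : ℕ → ℂ) (a : ℕ) {e f : ℕ → ℕ} (h : ∀ n, e n = a + f n) :
    weightedSum q ε e = q ^ a * weightedSum q ε f := by
  rw [weightedSum, weightedSum, ← tsum_mul_left]
  exact tsum_congr fun n => by rw [h]; ring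

lemma weightedSum_dropZero (q : ℂ) (ε : ℕ → ℂ) (e : ℕ → ℕ) :
    weightedSum q (dropZero ε) e = weightedSum q (fun n => ε (n + 1)) fun n => e (n + 1) := by
  rw [weightedSum, weightedSum, ← Nat.succ_injective.tsum_eq]
  · simp
  · intro n hn
    cases n with
    | zero => simp at hn
    | succ n => exact ⟨n, rfl⟩

lemma weightedSum_neg (q : ℂ) (ε : ℕ → ℂ) (e : ℕ → ℕ) :
    weightedSum q (fun n => -ε n) e = -weightedSum q ε e := by
  rw [weightedSum, weightedSum, ← tsum_neg]
  exact tsum_congr fun n => by ring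

/-- The terms of the double series, indexed by the exponent of `z` and the inner variable. -/
noncomputable def crankGrid (z q : ℂ) (ε : ℕ → ℂ) (e : ℕ → ℕ → ℕ) (r n : ℕ) : ℂ :=
  crankFactor z r * (-1) ^ (r + 1) * (ε n * q ^ e r n)

/-- A double sequence with its first index shifted by one. -/
def shiftGrid (F : ℕ → ℕ → ℂ) : ℕ → ℕ → ℂ
  | 0, _ => 0
  | r + 1, n => F r n

lemma summable_crankGrid {z q : ℂ} (hq : ‖q‖ < 1) {ε : ℕ → ℂ} {e : ℕ → ℕ → ℕ}
    (hε : ∀ n, ‖ε n‖ ≤ 1) (he : ∀ r n, r.choose 2 + n.choose 2 ≤ e r n) :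
    Summable (Function.uncurry (crankGrid z q ε e)) := by
  have h := (summable_norm_crankFactor (z := z) (norm_nonneg q) hq).mul_of_nonneg
    (summable_pow_mul_pow_choose 1 (norm_nonneg q) hq) (fun _ => by positivity)
    (fun _ => by positivity)
  refine h.of_norm_bounded fun p => ?_
  simp only [Function.uncurry, crankGrid, norm_mul, norm_pow, norm_neg, norm_one, one_pow,
    one_mul, mul_one]
  rw [mul_assoc, ← pow_add]
  gcongr
  calc ‖ε p.2‖ * ‖q‖ ^ e p.1 p.2 ≤ 1 * ‖q‖ ^ (p.1.choose 2 + p.2.choose 2) :=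
        mul_le_mul (hε _) (pow_le_pow_of_le_one (norm_nonneg _) hq.le (he _ _)) (by positivity)
          zero_le_one
    _ = _ := one_mul _

lemma tsum_crankGrid (z q : ℂ) (ε : ℕ → ℂ) (e : ℕ → ℕ → ℕ) (r : ℕ) :
    ∑' n, crankGrid z q ε e r n =
      crankFactor z r * (-1) ^ (r + 1) * weightedSum q ε (e r) := by
  simp only [crankGrid, tsum_mul_left, weightedSum]

lemma summable_weightedSum {z q : ℂ} (hq : ‖q‖ < 1) {ε : ℕ → ℂ} {e : ℕ → ℕ → ℕ}
    (hε : ∀ n, ‖ε n‖ ≤ 1) (he : ∀ r n, r.choose 2 + n.choose 2 ≤ e r n) :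
    Summable fun r : ℕ => crankFactor z r * (-1) ^ (r + 1) * weightedSum q ε (e r) := by
  simpa only [Function.uncurry, tsum_crankGrid] using (summable_crankGrid (z := z) hq hε he).prod

lemma hasSum_crankGrid {z q : ℂ} (hq : ‖q‖ < 1) {c : ℕ} (hc : 0 < c) {ε : ℕ → ℂ}
    {e : ℕ → ℕ → ℕ} (hε : ∀ n, ‖ε n‖ ≤ 1) (he : ∀ r n, r.choose 2 + n.choose 2 ≤ e r n) :
    HasSum (fun k : ℕ => ∑ n ∈ range (k / c + 1), crankGrid z q ε e (k - c * n) n)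
      (∑' r : ℕ, crankFactor z r * (-1) ^ (r + 1) * weightedSum q ε (e r)) := by
  simpa only [tsum_crankGrid] using hasSum_sum_range_div hc (summable_crankGrid (z := z) hq hε he)

/-- Serves the series whose line index is j = r + 1: the added row j = 0 is zero and leaves the
total unchanged. -/
lemma hasSum_shiftGrid {z q : ℂ} (hq : ‖q‖ < 1) {c : ℕ} (hc : 0 < c) {ε : ℕ → ℂ}
    {e : ℕ → ℕ → ℕ} (hε : ∀ n, ‖ε n‖ ≤ 1) (he : ∀ r n, r.choose 2 + n.choose 2 ≤ e r n) :
    HasSum (fun k : ℕ => ∑ n ∈ range (k / c + 1), shiftGrid (crankGrid z q ε e) (k - c * n) n)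
      (∑' r : ℕ, crankFactor z r * (-1) ^ (r + 1) * weightedSum q ε (e r)) := by
  have hinj : Function.Injective fun p : ℕ × ℕ => (p.1 + 1, p.2) := by
    intro p p' h
    simpa [Prod.ext_iff] using h
  have hs : Summable (Function.uncurry (shiftGrid (crankGrid z q ε e))) := by
    rw [← hinj.summable_iff]
    · exact summable_crankGrid hq hε he
    · rintro ⟨j, n⟩ h
      cases j with
      | zero => rfl
      | succ j => exact absurd ⟨(j, n), rfl⟩ h
  have h := hasSum_sum_range_div hc hs
  rw [← Nat.succ_injective.tsum_eq (f := fun j => ∑' n, shiftGrid (crankGrid z q ε e) j n)] at h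
  · simpa only [Nat.succ_eq_add_one, shiftGrid, tsum_crankGrid] using h
  · intro j hj
    cases j with
    | zero => simp [shiftGrid] at hj
    | succ j => exact ⟨j, rfl⟩

lemma HasSum.comp_natCast_succ {h : ℤ → ℂ} {s : ℂ} (hs : HasSum (fun k : ℕ => h k) s)
    (h0 : h 0 = 0) : HasSum (fun k : ℕ => h ((k : ℤ) + 1)) s := by
  have := (hasSum_nat_add_iff' 1).2 hs
  simpa [h0] using this

/-! ### The Hecke inner sums as line sums of grids -/

lemma two_mul_choose_two (n : ℕ) : 2 * (n.choose 2 : ℤ) = n * (n - 1) := by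
  induction n with
  | zero => simp
  | succ n ih =>
    rw [Nat.choose_succ_succ', Nat.choose_one_right]
    push_cast
    linear_combination ih

lemma neg_one_zpow_eq_pow {a : ℤ} (b : ℕ) (c : ℤ) (h : a = b + 2 * c) :
    (-1 : ℂ) ^ a = (-1) ^ b := by
  rw [h, zpow_add₀ (by norm_num), zpow_mul, zpow_natCast]
  norm_num

lemma term_eq_crankGrid {z q s x y : ℂ} {ε : ℕ → ℂ} {e : ℕ → ℕ → ℕ} {j n : ℕ} {E : ℤ}
    (hs : s = -(-1) ^ j * ε n) (hx : x = 1 - z ^ ((j : ℤ) + 1)) (hy : y = 1 - z ^ (-(j : ℤ)))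
    (hE : E = e j n) : s * x * y * q ^ E = crankGrid z q ε e j n := by
  rw [hs, hx, hy, hE, crankGrid, crankFactor, zpow_natCast]
  ring

/-- For j = 0 the factor x = 1 - z^0 vanishes, so exponents need to agree only for j ≥ 1. -/
lemma term_eq_shiftGrid {z q s x y : ℂ} {ε : ℕ → ℂ} {e : ℕ → ℕ → ℕ} {j n : ℕ} {E : ℤ}
    (hs : s = (-1) ^ j * ε n) (hx : x = 1 - z ^ (j : ℤ)) (hy : y = 1 - z ^ (1 - (j : ℤ)))
    (hE : ∀ r, j = r + 1 → E = e r n) :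
    s * x * y * q ^ E = shiftGrid (crankGrid z q ε e) j n := by
  cases j with
  | zero => simp [hx, shiftGrid]
  | succ r =>
    refine term_eq_crankGrid (by rw [hs]; ring) (by rw [hx]; push_cast; rfl)
      (by rw [hy]; push_cast; ring_nf) (hE r rfl)

lemma dropZero_eq_crankGrid {z q : ℂ} {u ε : ℕ → ℂ} {e : ℕ → ℕ → ℕ} {j n : ℕ}
    (h : n ≠ 0 → u n = crankGrid z q ε e j n) :
    dropZero u n = crankGrid z q (dropZero ε) e j n := by
  cases n with
  | zero => simp [crankGrid]
  | succ n => rw [dropZero_succ, h n.succ_ne_zero, crankGrid, crankGrid, dropZero_succ]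

lemma dropZero_eq_shiftGrid {z q : ℂ} {u ε : ℕ → ℂ} {e : ℕ → ℕ → ℕ} {j n : ℕ}
    (h : n ≠ 0 → u n = shiftGrid (crankGrid z q ε e) j n) :
    dropZero u n = shiftGrid (crankGrid z q (dropZero ε) e) j n := by
  cases j with
  | zero =>
    cases n with
    | zero => rfl
    | succ n => exact h n.succ_ne_zero
  | succ j => exact dropZero_eq_crankGrid h

lemma sum_range_div_congr {c k : ℕ} {u : ℕ → ℂ} {g : ℕ → ℕ → ℂ}
    (h : ∀ j n, k = j + c * n → u n = g j n) :
    ∑ n ∈ range (k / c + 1), u n = ∑ n ∈ range (k / c + 1), g (k - c * n) n := by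
  refine sum_congr rfl fun n hn => h _ _ ?_
  have := Nat.mul_le_of_le_div c n k (Nat.lt_succ_iff.1 (mem_range.1 hn))
  rw [mul_comm] at this
  lia

/-- The two grids are the halves n ≥ 0 and n < 0, both on the lines k = j + 2|n|; the term -n in the
exponent separates them. -/
lemma heckeA1_eq (z q : ℂ) (k : ℕ) :
    heckeA1 z q k = ∑ n ∈ range (k / 2 + 1), shiftGrid (crankGrid z q (fun n => (-1) ^ n)
        fun r n => (r + 1).choose 2 + (n.choose 2 + (2 * r + 1) * n)) (k - 2 * n) n +
      ∑ n ∈ range (k / 2 + 1), shiftGrid (crankGrid z q (dropZero fun n => (-1) ^ n)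
        fun r n => (r + 1).choose 2 + ((n + 1).choose 2 + (2 * r + 1) * n)) (k - 2 * n) n := by
  rw [heckeA1, show (k : ℤ) / 2 = (k / 2 : ℕ) by simp, sum_Icc_neg_natCast]
  congr 1
  · refine sum_range_div_congr fun j n hk => ?_
    subst hk
    refine term_eq_shiftGrid ?_ ?_ ?_ ?_
    · rw [neg_one_zpow_eq_pow (j + n) n (by push_cast; ring), pow_add]
    · rw [Nat.abs_cast]; push_cast; ring_nf
    · rw [Nat.abs_cast]; push_cast; ring_nf
    · rintro r rfl
      refine Int.ediv_eq_of_eq_mul_right two_ne_zero ?_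
      have h2 := two_mul_choose_two (r + 1)
      push_cast at h2 ⊢
      linear_combination -two_mul_choose_two n - h2
  · refine sum_range_div_congr fun j n hk => dropZero_eq_shiftGrid fun _ => ?_
    subst hk
    refine term_eq_shiftGrid ?_ ?_ ?_ ?_
    · rw [neg_one_zpow_eq_pow (j + n) 0 (by push_cast; ring), pow_add]
    · rw [abs_neg, Nat.abs_cast]; push_cast; ring_nf
    · rw [abs_neg, Nat.abs_cast]; push_cast; ring_nf
    · rintro r rfl
      refine Int.ediv_eq_of_eq_mul_right two_ne_zero ?_
      have h1 := two_mul_choose_two (n + 1)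
      have h2 := two_mul_choose_two (r + 1)
      push_cast at h1 h2 ⊢
      linear_combination -h1 - h2

lemma heckeA3a_eq (z q : ℂ) (k : ℕ) :
    heckeA3a z q k = ∑ n ∈ range (k / 2 + 1), crankGrid z q (dropZero fun n => -(-1) ^ n)
        (fun r n => r.choose 2 + (n.choose 2 + 2 * r * n)) (k - 2 * n) n := by
  rw [heckeA3a, show (k : ℤ) / 2 = (k / 2 : ℕ) by simp, sum_Icc_one_natCast]
  refine sum_range_div_congr fun j n hk => dropZero_eq_crankGrid fun _ => ?_
  subst hk
  refine term_eq_crankGrid ?_ ?_ ?_ ?_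
  · rw [neg_one_zpow_eq_pow (j + n) n (by push_cast; ring)]; ring
  · push_cast; ring_nf
  · push_cast; ring_nf
  · refine Int.ediv_eq_of_eq_mul_right two_ne_zero ?_
    push_cast
    linear_combination -two_mul_choose_two n - two_mul_choose_two j

lemma heckeA3b_eq (z q : ℂ) (k : ℕ) :
    heckeA3b z q k = ∑ n ∈ range (k / 2 + 1), shiftGrid (crankGrid z q (fun n => (-1) ^ n)
        fun r n => (r + 2).choose 2 + ((n + 1).choose 2 + (2 * r + 2) * n)) (k - 2 * n) n := by
  rw [heckeA3b, show (k : ℤ) / 2 = (k / 2 : ℕ) by simp, sum_Icc_zero_natCast]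
  refine sum_range_div_congr fun j n hk => ?_
  subst hk
  refine term_eq_shiftGrid ?_ ?_ ?_ ?_
  · rw [neg_one_zpow_eq_pow (j + n) n (by push_cast; ring), pow_add]
  · push_cast; ring_nf
  · push_cast; ring_nf
  · rintro r rfl
    refine Int.ediv_eq_of_eq_mul_right two_ne_zero ?_
    have h1 := two_mul_choose_two (n + 1)
    have h2 := two_mul_choose_two (r + 2)
    push_cast at h1 h2 ⊢
    linear_combination -h1 - h2

/-- With k = j + 3n the sign (-1)^{n+k} is (-1)^j, so the weights in n are constant, here and in the
other C1 sums. -/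
lemma heckeC1a_eq (z q : ℂ) (k : ℕ) :
    heckeC1a z q k = ∑ n ∈ range (k / 3 + 1), shiftGrid (crankGrid z q (fun _ => 1)
        fun r n => (r + 1).choose 2 + (n ^ 2 + n.choose 2 + 3 * (r + 1) * n)) (k - 3 * n) n := by
  rw [heckeC1a, show (k : ℤ) / 3 = (k / 3 : ℕ) by simp, sum_Icc_zero_natCast]
  refine sum_range_div_congr fun j n hk => ?_
  subst hk
  rw [mul_right_comm (_ ^ _)]
  refine term_eq_shiftGrid ?_ ?_ ?_ ?_
  · rw [neg_one_zpow_eq_pow j (2 * n) (by push_cast; ring)]; ring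
  · push_cast; ring_nf
  · push_cast; ring_nf
  · rintro r rfl
    rw [sub_add_eq_add_sub, sub_eq_iff_eq_add, ← eq_sub_iff_add_eq]
    refine Int.ediv_eq_of_eq_mul_right two_ne_zero ?_
    have h2 := two_mul_choose_two (r + 1)
    push_cast at h2 ⊢
    linear_combination -two_mul_choose_two n - h2

lemma heckeC1b_eq (z q : ℂ) (k : ℕ) :
    heckeC1b z q k = ∑ n ∈ range (k / 3 + 1), shiftGrid (crankGrid z q (fun _ => 1)
        fun r n => (r + 2).choose 2 + (n ^ 2 + n.choose 2 + 3 * (r + 1) * n + n))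
          (k - 3 * n) n := by
  rw [heckeC1b, show (k : ℤ) / 3 = (k / 3 : ℕ) by simp, sum_Icc_zero_natCast]
  refine sum_range_div_congr fun j n hk => ?_
  subst hk
  rw [mul_right_comm (_ ^ _)]
  refine term_eq_shiftGrid ?_ ?_ ?_ ?_
  · rw [neg_one_zpow_eq_pow j (2 * n) (by push_cast; ring)]; ring
  · push_cast; ring_nf
  · push_cast; ring_nf
  · rintro r rfl
    rw [sub_eq_iff_eq_add, sub_eq_iff_eq_add]
    refine Int.ediv_eq_of_eq_mul_right two_ne_zero ?_
    have h2 := two_mul_choose_two (r + 2)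
    push_cast at h2 ⊢
    linear_combination -two_mul_choose_two n - h2

lemma heckeC1c_eq (z q : ℂ) (k : ℕ) :
    heckeC1c z q k = ∑ n ∈ range (k / 3 + 1), crankGrid z q (dropZero fun _ => -1)
        (fun r n => r.choose 2 + (n ^ 2 + n.choose 2 + 3 * r * n)) (k - 3 * n) n := by
  rw [heckeC1c, show (k : ℤ) / 3 = (k / 3 : ℕ) by simp, sum_Icc_one_natCast]
  refine sum_range_div_congr fun j n hk => dropZero_eq_crankGrid fun _ => ?_
  subst hk
  rw [mul_right_comm (_ ^ _)]
  refine term_eq_crankGrid ?_ ?_ ?_ ?_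
  · rw [neg_one_zpow_eq_pow j (2 * n) (by push_cast; ring)]; ring
  · push_cast; ring_nf
  · push_cast; ring_nf
  · rw [sub_add_eq_add_sub, sub_eq_iff_eq_add, ← eq_sub_iff_add_eq]
    refine Int.ediv_eq_of_eq_mul_right two_ne_zero ?_
    push_cast
    linear_combination -two_mul_choose_two n - two_mul_choose_two j

lemma heckeC1d_eq (z q : ℂ) (k : ℕ) :
    heckeC1d z q k = ∑ n ∈ range (k / 3 + 1), crankGrid z q (dropZero fun _ => -1)
        (fun r n => (r + 1).choose 2 + (n ^ 2 + n.choose 2 + 3 * r * n + n)) (k - 3 * n) n := by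
  rw [heckeC1d, show (k : ℤ) / 3 = (k / 3 : ℕ) by simp, sum_Icc_one_natCast]
  refine sum_range_div_congr fun j n hk => dropZero_eq_crankGrid fun _ => ?_
  subst hk
  rw [mul_right_comm (_ ^ _)]
  refine term_eq_crankGrid ?_ ?_ ?_ ?_
  · rw [neg_one_zpow_eq_pow j (2 * n) (by push_cast; ring)]; ring
  · push_cast; ring_nf
  · push_cast; ring_nf
  · rw [sub_eq_iff_eq_add, sub_eq_iff_eq_add]
    refine Int.ediv_eq_of_eq_mul_right two_ne_zero ?_
    have h2 := two_mul_choose_two (j + 1)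
    push_cast at h2 ⊢
    linear_combination -two_mul_choose_two n - h2

lemma heckeE4a_eq (z q : ℂ) (k : ℕ) :
    heckeE4a z q k = ∑ n ∈ range (k / 2 + 1), crankGrid z q (dropZero fun n => -(-1) ^ n)
        (fun r n => r.choose 2 + (2 * n.choose 2 + 2 * r * n)) (k - 2 * n) n := by
  rw [heckeE4a, show (k : ℤ) / 2 = (k / 2 : ℕ) by simp, sum_Icc_one_natCast]
  refine sum_range_div_congr fun j n hk => dropZero_eq_crankGrid fun _ => ?_
  subst hk
  rw [mul_right_comm (_ ^ _)]
  refine term_eq_crankGrid ?_ ?_ ?_ ?_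
  · rw [neg_one_zpow_eq_pow (j + n) n (by push_cast; ring)]; ring
  · push_cast; ring_nf
  · push_cast; ring_nf
  · rw [sub_eq_iff_eq_add]
    refine Int.ediv_eq_of_eq_mul_right two_ne_zero ?_
    push_cast
    linear_combination -2 * two_mul_choose_two n - two_mul_choose_two j

lemma heckeE4b_eq (z q : ℂ) (k : ℕ) :
    heckeE4b z q k = ∑ n ∈ range (k / 2 + 1), shiftGrid (crankGrid z q (fun n => (-1) ^ n)
        fun r n => (r + 2).choose 2 + (n ^ 2 + (2 * r + 3) * n)) (k - 2 * n) n := by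
  rw [heckeE4b, show (k : ℤ) / 2 = (k / 2 : ℕ) by simp, sum_Icc_zero_natCast]
  refine sum_range_div_congr fun j n hk => ?_
  subst hk
  rw [mul_right_comm (_ ^ _)]
  refine term_eq_shiftGrid ?_ ?_ ?_ ?_
  · rw [neg_one_zpow_eq_pow (j + n) n (by push_cast; ring), pow_add]
  · push_cast; ring_nf
  · push_cast; ring_nf
  · rintro r rfl
    rw [sub_eq_iff_eq_add]
    refine Int.ediv_eq_of_eq_mul_right two_ne_zero ?_
    have h2 := two_mul_choose_two (r + 2)
    push_cast at h2 ⊢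
    linear_combination -h2

/-! ### The four Hecke-type identities -/

lemma exists_norm_pow_mul_le {q : ℂ} {u : ℕ → ℂ} {l : ℂ} (h : Tendsto u atTop (𝓝 l)) :
    ∃ C : ℝ, ∀ n, ‖q ^ n * u n‖ ≤ C * ‖q‖ ^ n := by
  obtain ⟨C, -, hC⟩ := exists_norm_le_of_tendsto h
  refine ⟨C, fun n => ?_⟩
  rw [norm_mul, norm_pow, mul_comm]
  gcongr
  exact hC n

lemma exists_norm_pow_two_mul_le {q : ℂ} (hq : ‖q‖ < 1) {u : ℕ → ℂ} {l : ℂ}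
    (h : Tendsto u atTop (𝓝 l)) : ∃ C : ℝ, ∀ n, ‖q ^ (2 * n) * u n‖ ≤ C * ‖q‖ ^ n := by
  obtain ⟨C, hC⟩ := exists_norm_pow_mul_le (q := q)
    ((tendsto_pow_atTop_nhds_zero_of_norm_lt_one hq).mul h)
  exact ⟨C, fun n => by rw [two_mul, pow_add, mul_assoc]; exact hC n⟩

lemma tendsto_qPochInf_pow_two_mul {q : ℂ} (hq : ‖q‖ < 1) :
    Tendsto (fun n : ℕ => qPochInf (q ^ (2 * n + 1)) q) atTop (𝓝 1) := by
  have h := (tendsto_qPochInf_mul_pow hq q).comp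
    (tendsto_id.const_mul_atTop' (r := 2) two_pos : Tendsto (fun n : ℕ => 2 * n) atTop atTop)
  refine h.congr fun n => ?_
  rw [Function.comp, pow_succ']

lemma tendsto_qPochInf_pow_sq {q : ℂ} (hq : ‖q‖ < 1) (a : ℕ) :
    Tendsto (fun n : ℕ => qPochInf (q ^ (2 * n + a)) (q ^ 2)) atTop (𝓝 1) := by
  refine (tendsto_qPochInf_mul_pow (norm_sq_lt_one hq) (q ^ a)).congr fun n => ?_
  rw [← pow_mul, ← pow_add, add_comm]

lemma tendsto_qPochInf_pow_succ {q : ℂ} (hq : ‖q‖ < 1) :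
    Tendsto (fun n : ℕ => qPochInf (q ^ (n + 1)) q) atTop (𝓝 1) := by
  refine (tendsto_qPochInf_mul_pow hq q).congr fun n => ?_
  rw [pow_succ']

lemma qPoch_two_mul_qPochInf {q : ℂ} (hq : ‖q‖ < 1) (n : ℕ) :
    qPoch q q (2 * n) * qPochInf (q ^ (2 * n + 1)) q = qPochInf q q := by
  rw [qPochInf_self_eq hq (2 * n), pow_succ']

lemma qPoch_two_mul_qPochInf_sq {q : ℂ} (hq : ‖q‖ < 1) (n : ℕ) :
    qPoch q q (2 * n) * (qPochInf (q ^ (2 * n + 1)) (q ^ 2) *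
      qPochInf (q ^ (2 * n + 2)) (q ^ 2)) = qPochInf q q := by
  rw [pow_succ q (2 * n + 1), qPochInf_even_mul_odd hq, qPoch_two_mul_qPochInf hq]

lemma norm_neg_one_pow_le (n : ℕ) : ‖(-1 : ℂ) ^ n‖ ≤ 1 := by simp

lemma norm_dropZero_le {u : ℕ → ℂ} (h : ∀ n, ‖u n‖ ≤ 1) (n : ℕ) : ‖dropZero u n‖ ≤ 1 := by
  cases n with
  | zero => simp
  | succ n => simpa using h (n + 1)

lemma choose_two_succ (n : ℕ) : (n + 1).choose 2 = n + n.choose 2 := by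
  rw [Nat.choose_succ_succ', Nat.choose_one_right]

theorem sptCrankA1_hecke {z q : ℂ} (hq0 : q ≠ 0) (hq : ‖q‖ < 1) (hz : z ≠ 0)
    (hpole : ∀ n : ℕ, 1 ≤ n → z * q ^ n ≠ 1 ∧ z⁻¹ * q ^ n ≠ 1) :
    Summable (fun n : ℕ => sptTermA1 z q (n + 1)) ∧
    Summable (fun k : ℕ => heckeA1 z q (k : ℤ)) ∧
    heckePrefactor z q * sptCrankA1 z q = ∑' k : ℕ, heckeA1 z q (k : ℤ) := by
  obtain ⟨C, hC⟩ := exists_norm_pow_mul_le (q := q) (tendsto_qPochInf_pow_two_mul hq)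
  obtain ⟨hs, ht⟩ := heckePrefactor_mul_tsum hq0 hq hz hpole hC
  have hX : (fun n => qPochInf q q * (qPoch q q (2 * n) * (q ^ n * qPochInf (q ^ (2 * n + 1)) q)))
      = fun n => qPochInf q q ^ 2 * q ^ n := by
    ext n
    linear_combination qPochInf q q * q ^ n * qPoch_two_mul_qPochInf hq n
  rw [hX] at ht
  have b1 : ∀ r n : ℕ, r.choose 2 + n.choose 2 ≤
      (r + 1).choose 2 + (n.choose 2 + (2 * r + 1) * n) := fun r n => by
    rw [choose_two_succ]; lia
  have b2 : ∀ r n : ℕ, r.choose 2 + n.choose 2 ≤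
      (r + 1).choose 2 + ((n + 1).choose 2 + (2 * r + 1) * n) := fun r n => by
    rw [choose_two_succ, choose_two_succ]; lia
  have hh : HasSum (fun k : ℕ => heckeA1 z q (k : ℤ)) _ :=
    ((hasSum_shiftGrid hq two_pos norm_neg_one_pow_le b1).add
      (hasSum_shiftGrid hq two_pos (norm_dropZero_le norm_neg_one_pow_le) b2)).congr_fun
      fun k => heckeA1_eq z q k
  refine ⟨hs, hh.summable, ht.trans ?_⟩
  rw [hh.tsum_eq, ← (summable_weightedSum hq norm_neg_one_pow_le b1).tsum_add
    (summable_weightedSum hq (norm_dropZero_le norm_neg_one_pow_le) b2)]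
  refine tsum_congr fun r => ?_
  -- It remains to match, for each r, the evaluated conjugate sum with the two halves; q^r joins
  -- q^{r(r-1)/2} to give q^{r(r+1)/2}.
  rw [conjSum_pow hq, mul_left_comm (1 - _), one_sub_mul_signedSum hq _ (by lia),
    weightedSum_add q _ _ (fun n => rfl), weightedSum_add q _ _ (fun n => rfl),
    weightedSum_dropZero, weightedSum_neg_one_pow]
  simp only [pow_succ (-1 : ℂ), mul_neg_one, weightedSum_neg, weightedSum_neg_one_pow]
  rw [choose_two_succ]
  ring

theorem sptCrankA3_hecke {z q : ℂ} (hq0 : q ≠ 0) (hq : ‖q‖ < 1) (hz : z ≠ 0)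
    (hpole : ∀ n : ℕ, 1 ≤ n → z * q ^ n ≠ 1 ∧ z⁻¹ * q ^ n ≠ 1) :
    Summable (fun n : ℕ => sptTermA3 z q (n + 1)) ∧
    Summable (fun k : ℕ => heckeA3a z q ((k : ℤ) + 1)) ∧
    Summable (fun k : ℕ => heckeA3b z q ((k : ℤ) + 1)) ∧
    heckePrefactor z q * sptCrankA3 z q =
      (∑' k : ℕ, heckeA3a z q ((k : ℤ) + 1)) - (∑' k : ℕ, heckeA3b z q ((k : ℤ) + 1)) := by
  obtain ⟨C, hC⟩ := exists_norm_pow_two_mul_le hq (tendsto_qPochInf_pow_two_mul hq)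
  obtain ⟨hs, ht⟩ := heckePrefactor_mul_tsum hq0 hq hz hpole hC
  have hX : (fun n => qPochInf q q * (qPoch q q (2 * n) *
      (q ^ (2 * n) * qPochInf (q ^ (2 * n + 1)) q))) =
      fun n => qPochInf q q ^ 2 * q ^ (2 * n) := by
    ext n
    linear_combination qPochInf q q * q ^ (2 * n) * qPoch_two_mul_qPochInf hq n
  rw [hX] at ht
  have hn : ∀ n : ℕ, ‖-(-1 : ℂ) ^ n‖ ≤ 1 := by simp
  have b1 : ∀ r n : ℕ, r.choose 2 + n.choose 2 ≤
      r.choose 2 + (n.choose 2 + 2 * r * n) := fun r n => by lia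
  have b2 : ∀ r n : ℕ, r.choose 2 + n.choose 2 ≤
      (r + 2).choose 2 + ((n + 1).choose 2 + (2 * r + 2) * n) := fun r n => by
    rw [choose_two_succ, choose_two_succ, choose_two_succ]; lia
  have h1 : HasSum (fun k : ℕ => heckeA3a z q ((k : ℤ) + 1)) _ :=
    ((hasSum_crankGrid hq two_pos (norm_dropZero_le hn) b1).congr_fun
      fun k => heckeA3a_eq z q k).comp_natCast_succ (by simp [heckeA3a])
  have h2 : HasSum (fun k : ℕ => heckeA3b z q ((k : ℤ) + 1)) _ :=
    ((hasSum_shiftGrid hq two_pos norm_neg_one_pow_le b2).congr_fun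
      fun k => heckeA3b_eq z q k).comp_natCast_succ (by simp [heckeA3b])
  refine ⟨hs, h1.summable, h2.summable, ht.trans ?_⟩
  rw [h1.tsum_eq, h2.tsum_eq, ← (summable_weightedSum hq (norm_dropZero_le hn) b1).tsum_sub
    (summable_weightedSum hq norm_neg_one_pow_le b2)]
  refine tsum_congr fun r => ?_
  -- Moving the first series from n ≥ 1 to n ≥ 0 releases q^{2r}, the prefactor of the conjugate
  -- sum.
  rw [conjSum_pow_two hq, mul_left_comm (1 - _), one_sub_mul_signedSum_sub hq _ (by lia),
    weightedSum_dropZero,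
    weightedSum_add q _ (r.choose 2 + 2 * r) (f := fun n => n.choose 2 + (2 * r + 1) * n)
      fun n => by rw [choose_two_succ]; ring,
    weightedSum_add q _ (r.choose 2 + 2 * r)
      (e := fun n => (r + 2).choose 2 + ((n + 1).choose 2 + (2 * r + 2) * n))
      (f := fun n => (n + 2).choose 2 + (2 * r + 1) * n)
      fun n => by rw [choose_two_succ (r + 1), choose_two_succ r, choose_two_succ (n + 1)]; ring]
  simp only [pow_succ (-1 : ℂ), mul_neg_one, neg_neg, weightedSum_neg_one_pow]
  ring

theorem sptCrankC1_hecke {z q : ℂ} (hq0 : q ≠ 0) (hq : ‖q‖ < 1) (hz : z ≠ 0)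
    (hpole : ∀ n : ℕ, 1 ≤ n → z * q ^ n ≠ 1 ∧ z⁻¹ * q ^ n ≠ 1) :
    Summable (fun n : ℕ => sptTermC1 z q (n + 1)) ∧
    Summable (fun k : ℕ => heckeC1a z q ((k : ℤ) + 1)) ∧
    Summable (fun k : ℕ => heckeC1b z q ((k : ℤ) + 1)) ∧
    Summable (fun k : ℕ => heckeC1c z q ((k : ℤ) + 1)) ∧
    Summable (fun k : ℕ => heckeC1d z q ((k : ℤ) + 1)) ∧
    heckePrefactor z q * sptCrankC1 z q =
      (∑' k : ℕ, heckeC1a z q ((k : ℤ) + 1)) - (∑' k : ℕ, heckeC1b z q ((k : ℤ) + 1))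
      + (∑' k : ℕ, heckeC1c z q ((k : ℤ) + 1)) - (∑' k : ℕ, heckeC1d z q ((k : ℤ) + 1)) := by
  obtain ⟨C, hC⟩ := exists_norm_pow_mul_le (q := q)
    ((tendsto_qPochInf_pow_sq hq 1).mul (tendsto_qPochInf_pow_succ hq))
  obtain ⟨hs, ht⟩ := heckePrefactor_mul_tsum hq0 hq hz hpole hC
  have hX : (fun n => qPochInf q q * (qPoch q q (2 * n) *
      (q ^ n * (qPochInf (q ^ (2 * n + 1)) (q ^ 2) * qPochInf (q ^ (n + 1)) q)))) =
      fun n => qPochInf q q ^ 2 * q ^ n / qPochInf (-q ^ (n + 1)) q := by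
    ext n
    have h1 : ‖-q ^ (n + 1)‖ < 1 := by rw [norm_neg]; exact norm_pow_succ_lt_one hq n
    -- Here (q^{n+1}; q)_∞ is (q^{2n+2}; q²)_∞ divided by (-q^{n+1}; q)_∞, and the even product
    -- completes (q; q)_∞.
    have h2 := qPochInf_mul_neg hq (q ^ (n + 1))
    rw [show (q ^ (n + 1)) ^ 2 = q ^ (2 * n + 2) by ring] at h2
    rw [eq_div_iff (qPochInf_ne_zero_of_norm_lt_one hq h1)]
    linear_combination qPochInf q q * q ^ n * qPoch_two_mul_qPochInf_sq hq n +
      qPochInf q q * q ^ n * qPoch q q (2 * n) * qPochInf (q ^ (2 * n + 1)) (q ^ 2) * h2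
  rw [hX] at ht
  have hone : ∀ _ : ℕ, ‖(1 : ℂ)‖ ≤ 1 := by simp
  have hneg : ∀ _ : ℕ, ‖(-1 : ℂ)‖ ≤ 1 := by simp
  have ba : ∀ r n : ℕ, r.choose 2 + n.choose 2 ≤
      (r + 1).choose 2 + (n ^ 2 + n.choose 2 + 3 * (r + 1) * n) := fun r n => by
    rw [choose_two_succ]; lia
  have bb : ∀ r n : ℕ, r.choose 2 + n.choose 2 ≤
      (r + 2).choose 2 + (n ^ 2 + n.choose 2 + 3 * (r + 1) * n + n) := fun r n => by
    rw [choose_two_succ, choose_two_succ]; lia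
  have bc : ∀ r n : ℕ, r.choose 2 + n.choose 2 ≤
      r.choose 2 + (n ^ 2 + n.choose 2 + 3 * r * n) := fun r n => by lia
  have bd : ∀ r n : ℕ, r.choose 2 + n.choose 2 ≤
      (r + 1).choose 2 + (n ^ 2 + n.choose 2 + 3 * r * n + n) := fun r n => by
    rw [choose_two_succ]; lia
  have ha : HasSum (fun k : ℕ => heckeC1a z q ((k : ℤ) + 1)) _ :=
    ((hasSum_shiftGrid hq three_pos hone ba).congr_fun
      fun k => heckeC1a_eq z q k).comp_natCast_succ (by simp [heckeC1a])
  have hb : HasSum (fun k : ℕ => heckeC1b z q ((k : ℤ) + 1)) _ :=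
    ((hasSum_shiftGrid hq three_pos hone bb).congr_fun
      fun k => heckeC1b_eq z q k).comp_natCast_succ (by simp [heckeC1b])
  have hc : HasSum (fun k : ℕ => heckeC1c z q ((k : ℤ) + 1)) _ :=
    ((hasSum_crankGrid hq three_pos (norm_dropZero_le hneg) bc).congr_fun
      fun k => heckeC1c_eq z q k).comp_natCast_succ (by simp [heckeC1c])
  have hd : HasSum (fun k : ℕ => heckeC1d z q ((k : ℤ) + 1)) _ :=
    ((hasSum_crankGrid hq three_pos (norm_dropZero_le hneg) bd).congr_fun
      fun k => heckeC1d_eq z q k).comp_natCast_succ (by simp [heckeC1d])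
  refine ⟨hs, ha.summable, hb.summable, hc.summable, hd.summable, ht.trans ?_⟩
  have sa := summable_weightedSum (z := z) hq hone ba
  have sb := summable_weightedSum (z := z) hq hone bb
  have sc := summable_weightedSum (z := z) hq (norm_dropZero_le hneg) bc
  have sd := summable_weightedSum (z := z) hq (norm_dropZero_le hneg) bd
  rw [ha.tsum_eq, hb.tsum_eq, hc.tsum_eq, hd.tsum_eq, ← sa.tsum_sub sb,
    ← (sa.sub sb).tsum_add sc, ← ((sa.sub sb).add sc).tsum_sub sd]
  refine tsum_congr fun r => ?_
  set u : ℕ → ℕ := fun n => n ^ 2 + n.choose 2 + 3 * (r + 1) * n with hu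
  have hsum (e : ℕ → ℕ) (he : ∀ n, n ≤ e n) : Summable fun n => (1 : ℂ) * q ^ e n :=
    summable_of_norm_le_const_mul_pow (C := 1) (norm_nonneg q) hq fun n => by
      simpa using pow_le_pow_of_le_one (norm_nonneg q) hq.le (he n)
  have hmain : conjSum q (fun n => qPochInf q q ^ 2 * q ^ n / qPochInf (-q ^ (n + 1)) q) r =
      q ^ r * (weightedSum q (fun _ => 1) u -
        q ^ (r + 1) * weightedSum q (fun _ => 1) fun n => u n + n) := by
    rw [conjSum_div_neg hq, weightedSum, weightedSum, ← tsum_mul_left (a := q ^ (r + 1)),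
      ← (hsum _ fun n => by simp only [hu]; nlinarith).tsum_sub
        ((hsum _ fun n => by lia).mul_left _)]
    congr 1
    refine tsum_congr fun n => ?_
    simp only [hu]
    ring
  -- Expanding 1 - q^{2r+1}, the term 1 gives the first two C1 series and -q^{2r+1} the last two,
  -- after their shift n ↦ n + 1.
  rw [hmain, weightedSum_dropZero, weightedSum_dropZero, weightedSum_neg, weightedSum_neg,
    weightedSum_add q _ ((r + 1).choose 2)
      (e := fun n => (r + 1).choose 2 + (n ^ 2 + n.choose 2 + 3 * (r + 1) * n)) (f := u)
      fun n => rfl,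
    weightedSum_add q _ ((r + 2).choose 2)
      (e := fun n => (r + 2).choose 2 + (n ^ 2 + n.choose 2 + 3 * (r + 1) * n + n))
      (f := fun n => u n + n) fun n => rfl,
    weightedSum_add q _ ((r + 1).choose 2 + (2 * r + 1))
      (e := fun n => r.choose 2 + ((n + 1) ^ 2 + (n + 1).choose 2 + 3 * r * (n + 1))) (f := u)
      fun n => by simp only [hu, choose_two_succ]; ring,
    weightedSum_add q _ ((r + 2).choose 2 + (2 * r + 1))
      (e := fun n => (r + 1).choose 2 +
        ((n + 1) ^ 2 + (n + 1).choose 2 + 3 * r * (n + 1) + (n + 1)))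
      (f := fun n => u n + n) fun n => by simp only [hu, choose_two_succ]; ring]
  simp only [choose_two_succ]
  ring

theorem sptCrankE4_hecke {z q : ℂ} (hq0 : q ≠ 0) (hq : ‖q‖ < 1) (hz : z ≠ 0)
    (hpole : ∀ n : ℕ, 1 ≤ n → z * q ^ n ≠ 1 ∧ z⁻¹ * q ^ n ≠ 1) :
    Summable (fun n : ℕ => sptTermE4 z q (n + 1)) ∧
    Summable (fun k : ℕ => heckeE4a z q ((k : ℤ) + 1)) ∧
    Summable (fun k : ℕ => heckeE4b z q ((k : ℤ) + 1)) ∧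
    heckePrefactor z q * sptCrankE4 z q =
      (∑' k : ℕ, heckeE4a z q ((k : ℤ) + 1)) - (∑' k : ℕ, heckeE4b z q ((k : ℤ) + 1)) := by
  obtain ⟨C, hC⟩ := exists_norm_pow_two_mul_le hq (tendsto_qPochInf_pow_sq hq 2)
  obtain ⟨hs, ht⟩ := heckePrefactor_mul_tsum hq0 hq hz hpole hC
  have hX : (fun n => qPochInf q q * (qPoch q q (2 * n) *
      (q ^ (2 * n) * qPochInf (q ^ (2 * n + 2)) (q ^ 2)))) =
      fun n => qPochInf q q ^ 2 * q ^ (2 * n) / qPochInf (q ^ (2 * n + 1)) (q ^ 2) := by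
    ext n
    rw [eq_div_iff (qPochInf_ne_zero_of_norm_lt_one (norm_sq_lt_one hq)
      (norm_pow_succ_lt_one hq _))]
    linear_combination qPochInf q q * q ^ (2 * n) * qPoch_two_mul_qPochInf_sq hq n
  rw [hX] at ht
  have hn : ∀ n : ℕ, ‖-(-1 : ℂ) ^ n‖ ≤ 1 := by simp
  have b1 : ∀ r n : ℕ, r.choose 2 + n.choose 2 ≤
      r.choose 2 + (2 * n.choose 2 + 2 * r * n) := fun r n => by lia
  have b2 : ∀ r n : ℕ, r.choose 2 + n.choose 2 ≤
      (r + 2).choose 2 + (n ^ 2 + (2 * r + 3) * n) := fun r n => by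
    have := two_mul_choose_two n
    rw [choose_two_succ, choose_two_succ]
    zify
    nlinarith
  have h1 : HasSum (fun k : ℕ => heckeE4a z q ((k : ℤ) + 1)) _ :=
    ((hasSum_crankGrid hq two_pos (norm_dropZero_le hn) b1).congr_fun
      fun k => heckeE4a_eq z q k).comp_natCast_succ (by simp [heckeE4a])
  have h2 : HasSum (fun k : ℕ => heckeE4b z q ((k : ℤ) + 1)) _ :=
    ((hasSum_shiftGrid hq two_pos norm_neg_one_pow_le b2).congr_fun
      fun k => heckeE4b_eq z q k).comp_natCast_succ (by simp [heckeE4b])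
  refine ⟨hs, h1.summable, h2.summable, ht.trans ?_⟩
  rw [h1.tsum_eq, h2.tsum_eq, ← (summable_weightedSum hq (norm_dropZero_le hn) b1).tsum_sub
    (summable_weightedSum hq norm_neg_one_pow_le b2)]
  refine tsum_congr fun r => ?_
  -- As for A3, both series share the power q^{r(r-1)/2 + 2r}, once the first is shifted to start at
  -- n = 0.
  rw [one_sub_mul_conjSum_div hq, weightedSum_dropZero,
    weightedSum_add q _ (r.choose 2 + 2 * r) (f := fun n => n ^ 2 + (2 * r + 1) * n)
      fun n => by
        have := two_mul_choose_two n
        rw [choose_two_succ]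
        zify
        linear_combination this,
    weightedSum_add q _ (r.choose 2 + 2 * r)
      (e := fun n => (r + 2).choose 2 + (n ^ 2 + (2 * r + 3) * n))
      (f := fun n => (n + 1) ^ 2 + (2 * r + 1) * n)
      fun n => by rw [choose_two_succ (r + 1), choose_two_succ r]; ring]
  simp only [pow_succ (-1 : ℂ), mul_neg_one, neg_neg, weightedSum_neg_one_pow]
  ring

theorem corollary2p3 (z q : ℂ) (hz : z ≠ 0) (hq0 : q ≠ 0) (hq1 : ‖q‖ < 1)
    (hpole : ∀ n : ℕ, 1 ≤ n → z * q ^ n ≠ 1 ∧ z⁻¹ * q ^ n ≠ 1) :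
    (Summable (fun n : ℕ => sptTermA1 z q (n + 1)) ∧
      Summable (fun k : ℕ => heckeA1 z q (k : ℤ)) ∧
      heckePrefactor z q * sptCrankA1 z q = ∑' k : ℕ, heckeA1 z q (k : ℤ)) ∧
    (Summable (fun n : ℕ => sptTermA3 z q (n + 1)) ∧
      Summable (fun k : ℕ => heckeA3a z q ((k : ℤ) + 1)) ∧
      Summable (fun k : ℕ => heckeA3b z q ((k : ℤ) + 1)) ∧
      heckePrefactor z q * sptCrankA3 z q =
        (∑' k : ℕ, heckeA3a z q ((k : ℤ) + 1)) - (∑' k : ℕ, heckeA3b z q ((k : ℤ) + 1))) ∧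
    (Summable (fun n : ℕ => sptTermC1 z q (n + 1)) ∧
      Summable (fun k : ℕ => heckeC1a z q ((k : ℤ) + 1)) ∧
      Summable (fun k : ℕ => heckeC1b z q ((k : ℤ) + 1)) ∧
      Summable (fun k : ℕ => heckeC1c z q ((k : ℤ) + 1)) ∧
      Summable (fun k : ℕ => heckeC1d z q ((k : ℤ) + 1)) ∧
      heckePrefactor z q * sptCrankC1 z q =
        (∑' k : ℕ, heckeC1a z q ((k : ℤ) + 1)) - (∑' k : ℕ, heckeC1b z q ((k : ℤ) + 1))
        + (∑' k : ℕ, heckeC1c z q ((k : ℤ) + 1)) - (∑' k : ℕ, heckeC1d z q ((k : ℤ) + 1))) ∧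
    (Summable (fun n : ℕ => sptTermE4 z q (n + 1)) ∧
      Summable (fun k : ℕ => heckeE4a z q ((k : ℤ) + 1)) ∧
      Summable (fun k : ℕ => heckeE4b z q ((k : ℤ) + 1)) ∧
      heckePrefactor z q * sptCrankE4 z q =
        (∑' k : ℕ, heckeE4a z q ((k : ℤ) + 1)) - (∑' k : ℕ, heckeE4b z q ((k : ℤ) + 1))) :=
  ⟨sptCrankA1_hecke hq0 hq1 hz hpole, sptCrankA3_hecke hq0 hq1 hz hpole,
    sptCrankC1_hecke hq0 hq1 hz hpole, sptCrankE4_hecke hq0 hq1 hz hpole⟩
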